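/- Let $\mathcal{C}$ be a small coherent category (finite limits, pullback-stable factorisations into an effective epimorphism followed by a monomorphism, pullback-stable finite unions of subobjects), and assume that $\mathcal{C}$ has finite disjoint coproducts or is Boolean (every subobject is complemented). Let $Spec^{\neg}(\mathcal{C})$ be the following category. Its objects are the pairs $(x,p)$ with $x\in\mathcal{C}$ and $p$ an ultrafilter on the Boolean algebra of complemented subobjects of $x$. A $p$-germ of maps $x\to y$ is an equivalence class of partial maps $f:x\supseteq u\to y$ with $u\in p$, where two partial maps are identified if they are both defined and agree on some member of $p$. The morphisms $(x,p)\to(y,q)$ are the $p$-germs $[f]$ of maps $x\to y$ that are continuous, i.e. such that $v\in q$ implies $f^{-1}(v)\in p$. For $f:x\to y$ in $\mathcal{C}$ and an ultrafilter $p$ on $x$ write $f_!p=\{v : f^{-1}(v)\in p\}$, where $v$ ranges over the complemented subobjects of $y$. Let $\tau_E$ be the Grothendieck topology on $Spec^{\neg}(\mathcal{C})$ generated by the families $\left([f]:(x,p)\to(y,q)\right)_{p:\ f_!p=q}$ (all ultrafilters $p$ on $x$ with $f_!p=q$), for all effective epimorphisms $f:x\to y$ of $\mathcal{C}$ and all ultrafilters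 $q$ on $y$. Let $\varphi:\mathcal{C}\to Sh(Spec^{\neg}(\mathcal{C}),\tau_E)$ send $y$ to the sheafification of the presheaf which takes $(x,p)$ to the set of $p$-germs of maps $x\to y$. A functor is called coherent if it preserves finite limits, effective epimorphisms and finite unions of subobjects, and lex cocontinuous if it preserves finite limits and all small colimits. Write $\mathbf{Coh}(\mathcal{C},\mathcal{E})$ for the category of coherent functors $\mathcal{C}\to\mathcal{E}$ and $Fun^*(\mathcal{D},\mathcal{E})$ for the category of lex cocontinuous functors $\mathcal{D}\to\mathcal{E}$, each with all natural transformations as morphisms. Then: (i) $\varphi$ is coherent. (ii) For every Grothendieck topos $\mathcal{E}$, precomposition with $\varphi$ is a well-defined and fully faithful functor $\varphi^{\circ}: Fun^*(Sh(Spec^{\neg}(\mathcal{C}),\tau_E),\mathcal{E})\to\mathbf{Coh}(\mathcal{C},\mathcal{E})$. (iii) If moreover $\mathcal{E}$ is locally connected, i.e. every object of $\mathcal{E}$ is a disjoint coproduct of connected objects (non-initial objects that are indecomposable as a binary coproduct), then $\varphi^{\circ}$ is an equivalence of categories. -/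

import Mathlib

open CategoryTheory CategoryTheory.Limits

universe w v₁ v₂ u u₁ u₂

/-! ### Coherent categories and coherent functors -/

/-- A coherent category: a regular category (finite limits, pullback-stable factorisations into an
effective epimorphism followed by a monomorphism) with pullback-stable finite unions of
subobjects. -/
class CoherentCategory (C : Type u₁) [Category.{v₁} C] : Prop extends Regular C where
  exists_isBot (X : C) : ∃ B : Subobject X, IsBot B
  exists_isLUB {X : C} (S T : Subobject X) : ∃ U : Subobject X, IsLUB {S, T} U
  isBot_pullback {X Y : C} (f : X ⟶ Y) {B : Subobject Y} (hB : IsBot B) :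
    IsBot ((Subobject.pullback f).obj B)
  isLUB_pullback {X Y : C} (f : X ⟶ Y) {S T U : Subobject Y} (hU : IsLUB {S, T} U) :
    IsLUB {(Subobject.pullback f).obj S, (Subobject.pullback f).obj T}
      ((Subobject.pullback f).obj U)

/-- The subobject `F S` of `F X` induced by a subobject `S` of `X`, for `F` left exact. -/
noncomputable def Subobject.mapLex {C : Type u₁} [Category.{v₁} C] {D : Type u₂} [Category.{v₂} D]
    (F : C ⥤ D) [PreservesFiniteLimits F] {X : C} (S : Subobject X) : Subobject (F.obj X) :=
  Subobject.mk (F.map S.arrow)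

/-- A coherent functor preserves finite limits, effective epimorphisms and finite unions of
subobjects. -/
structure IsCoherentFunctor {C : Type u₁} [Category.{v₁} C] {D : Type u₂} [Category.{v₂} D]
    (F : C ⥤ D) : Prop extends PreservesFiniteLimits F where
  effectiveEpi_map {X Y : C} (f : X ⟶ Y) : EffectiveEpi f → EffectiveEpi (F.map f)
  isBot_map {X : C} (B : Subobject X) : IsBot B → IsBot (Subobject.mapLex F B)
  isLUB_map {X : C} (S T U : Subobject X) : IsLUB {S, T} U →
    IsLUB {Subobject.mapLex F S, Subobject.mapLex F T} (Subobject.mapLex F U)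

/-- `T` is a complement of the subobject `S`. -/
def IsComplement {C : Type u₁} [Category.{v₁} C] [HasPullbacks C] {X : C}
    (S T : Subobject X) : Prop :=
  IsBot (S ⊓ T) ∧ IsLUB {S, T} ⊤

/-- `S` is a complemented subobject. -/
def IsComplementedSubobject {C : Type u₁} [Category.{v₁} C] [HasPullbacks C] {X : C}
    (S : Subobject X) : Prop :=
  ∃ T : Subobject X, IsComplement S T

/-- Every subobject is complemented (a coherent category with this property is called Boolean). -/
def IsBooleanCategory (C : Type u₁) [Category.{v₁} C] [HasPullbacks C] : Prop :=
  ∀ (X : C) (S : Subobject X), IsComplementedSubobject S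

/-- Finite coproducts exist and are disjoint: the injections are monomorphisms and the
intersection of the two summands of a binary coproduct is initial. -/
def HasFiniteDisjointCoproducts (C : Type u₁) [Category.{v₁} C] : Prop :=
  HasFiniteCoproducts C ∧ BinaryCoproductsDisjoint C

/-! ### Ultrafilters of complemented subobjects -/

/-- An ultrafilter on the Boolean algebra of complemented subobjects of `X`. -/
@[ext]
structure BooleanType {C : Type u₁} [Category.{v₁} C] [HasPullbacks C] (X : C) where
  carrier : Set (Subobject X)
  complemented {S : Subobject X} : S ∈ carrier → IsComplementedSubobject S
  top_mem : ⊤ ∈ carrier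
  inf_mem {S T : Subobject X} : S ∈ carrier → T ∈ carrier → S ⊓ T ∈ carrier
  mem_of_le {S T : Subobject X} : S ∈ carrier → S ≤ T → IsComplementedSubobject T → T ∈ carrier
  not_mem_of_isBot {S : Subobject X} : IsBot S → S ∉ carrier
  mem_or_mem {S T : Subobject X} : IsComplement S T → S ∈ carrier ∨ T ∈ carrier

theorem pullback_arrow_self {C : Type u₁} [Category.{v₁} C] [HasPullbacks C] {X : C}
    (P : Subobject X) : (Subobject.pullback P.arrow).obj P = ⊤ := by
  have h := Subobject.pullback_self P.arrow
  rwa [Subobject.mk_arrow] at h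

section Complements

variable {C : Type u₁} [Category.{v₁} C] [CoherentCategory C]

theorem IsComplement.symm {X : C} {S T : Subobject X} (h : IsComplement S T) :
    IsComplement T S :=
  ⟨by rw [inf_comm]; exact h.1, by rw [Set.pair_comm]; exact h.2⟩

theorem IsComplement.pullback {X Y : C} (f : X ⟶ Y) {S T : Subobject Y} (h : IsComplement S T) :
    IsComplement ((Subobject.pullback f).obj S) ((Subobject.pullback f).obj T) := by
  constructor
  · rw [← Subobject.inf_pullback]
    exact CoherentCategory.isBot_pullback f h.1
  · rw [← Subobject.pullback_top f]
    exact CoherentCategory.isLUB_pullback f h.2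

theorem IsComplementedSubobject.pullback {X Y : C} (f : X ⟶ Y) {S : Subobject Y}
    (h : IsComplementedSubobject S) : IsComplementedSubobject ((Subobject.pullback f).obj S) :=
  ⟨_, h.choose_spec.pullback f⟩

theorem isBot_map_arrow {X : C} (P : Subobject X) {B : Subobject (P : C)} (hB : IsBot B) :
    IsBot ((Subobject.map P.arrow).obj B) := by
  obtain ⟨B₀, h₀⟩ := CoherentCategory.exists_isBot X
  intro S
  refine le_trans ?_ (h₀ S)
  exact ((Subobject.mapPullbackAdj P.arrow).gc _ _).mpr (hB _)

/-- The preimage of a complemented subobject under a partial map with complemented domain is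
complemented. -/
theorem IsComplementedSubobject.map_pullback {X Y : C} {P : Subobject X}
    (hP : IsComplementedSubobject P) (f : (P : C) ⟶ Y) {V : Subobject Y}
    (hV : IsComplementedSubobject V) :
    IsComplementedSubobject ((Subobject.map P.arrow).obj ((Subobject.pullback f).obj V)) := by
  obtain ⟨P', hP'⟩ := hP
  obtain ⟨V', hV'⟩ := hV
  have hf := hV'.pullback f
  set A := (Subobject.pullback f).obj V
  set A' := (Subobject.pullback f).obj V'
  have gc := (Subobject.mapPullbackAdj P.arrow).gc
  obtain ⟨Q, hQ⟩ := CoherentCategory.exists_isLUB ((Subobject.map P.arrow).obj A') P'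
  refine ⟨Q, ?_, ?_⟩
  · set M := (Subobject.map P.arrow).obj A
    have h1 : IsBot (M ⊓ (Subobject.map P.arrow).obj A') := by
      rw [← Subobject.inf_map]
      exact isBot_map_arrow P hf.1
    have h2 : IsBot (M ⊓ P') := by
      intro S
      refine le_trans (inf_le_inf_right _ ?_) (hP'.1 S)
      refine (gc _ _).mpr ?_
      rw [pullback_arrow_self P]
      exact le_top
    have key (R : Subobject X) (hR : IsBot (M ⊓ R)) (Z : Subobject (M : C)) :
        (Subobject.pullback M.arrow).obj R ≤ Z := by
      have hb := CoherentCategory.isBot_pullback M.arrow hR Z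
      rw [Subobject.inf_pullback, pullback_arrow_self M, top_inf_eq] at hb
      exact hb
    have h3 : IsBot ((Subobject.pullback M.arrow).obj Q) := by
      intro Z
      refine (CoherentCategory.isLUB_pullback M.arrow hQ).2 ?_
      rintro _ (rfl | rfl)
      · exact key _ h1 Z
      · exact key _ h2 Z
    intro S
    have h4 := isBot_map_arrow M h3 S
    have h5 := Subobject.inf_eq_map_pullback M Q
    exact le_trans (le_of_eq h5) h4
  · refine ⟨fun _ _ => le_top, fun U hU => ?_⟩
    have hA : A ≤ (Subobject.pullback P.arrow).obj U := (gc _ _).mp (hU (Or.inl rfl))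
    have hQU : Q ≤ U := hU (Or.inr rfl)
    have hA' : A' ≤ (Subobject.pullback P.arrow).obj U :=
      (gc _ _).mp (le_trans (hQ.1 (Or.inl rfl)) hQU)
    refine hP'.2.2 ?_
    rintro R (hR | hR)
    · rw [hR]
      have : (⊤ : Subobject _) ≤ (Subobject.pullback P.arrow).obj U := by
        refine hf.2.2 ?_
        rintro _ (rfl | rfl)
        · exact hA
        · exact hA'
      have := (gc _ _).mpr this
      rwa [Subobject.map_top, Subobject.mk_arrow] at this
    · rw [hR]
      exact le_trans (hQ.1 (Or.inr rfl)) hQU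

/-- The image `f_! p = {V | f⁻¹ V ∈ p}` of an ultrafilter `p` under `f : X ⟶ Y`. -/
def BooleanType.pushforward {X Y : C} (f : X ⟶ Y) (p : BooleanType X) : BooleanType Y where
  carrier := {V | IsComplementedSubobject V ∧ (Subobject.pullback f).obj V ∈ p.carrier}
  complemented h := h.1
  top_mem := by
    refine ⟨?_, by rw [Subobject.pullback_top]; exact p.top_mem⟩
    obtain ⟨B, hB⟩ := CoherentCategory.exists_isBot Y
    exact ⟨B, by rwa [top_inf_eq], fun _ _ => le_top, fun U hU => hU (Or.inl rfl)⟩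
  inf_mem := by
    rintro S T ⟨hS, hS'⟩ ⟨hT, hT'⟩
    refine ⟨?_, by rw [Subobject.inf_pullback]; exact p.inf_mem hS' hT'⟩
    rw [Subobject.inf_eq_map_pullback]
    exact hS.map_pullback S.arrow hT
  mem_of_le := by
    rintro S T ⟨hS, hS'⟩ hST hT
    exact ⟨hT, p.mem_of_le hS' ((Subobject.pullback f).monotone hST) (hT.pullback f)⟩
  not_mem_of_isBot hS h := p.not_mem_of_isBot (CoherentCategory.isBot_pullback f hS) h.2
  mem_or_mem {S T} h :=
    (p.mem_or_mem (h.pullback f)).imp (fun h' => ⟨⟨T, h⟩, h'⟩) (fun h' => ⟨⟨S, h.symm⟩, h'⟩)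

end Complements

/-! ### Germs -/

section Germs

variable {C : Type u₁} [Category.{v₁} C]

/-- A partial map from `X` to `Y` whose domain belongs to the ultrafilter `p`. -/
structure PartialMap [HasPullbacks C] {X : C} (p : BooleanType X) (Y : C) where
  dom : Subobject X
  dom_mem : dom ∈ p.carrier
  hom : (dom : C) ⟶ Y

namespace PartialMap

section

variable [HasPullbacks C] {X : C} {p : BooleanType X} {Y Z : C}

/-- Two partial maps are identified if they agree on some member of `p`. -/
def Rel (f g : PartialMap p Y) : Prop :=
  ∃ W ∈ p.carrier, ∃ (hf : W ≤ f.dom) (hg : W ≤ g.dom),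
    Subobject.ofLE W f.dom hf ≫ f.hom = Subobject.ofLE W g.dom hg ≫ g.hom

theorem Rel.of_hom {f g : PartialMap p Y} {W : Subobject X} (hW : W ∈ p.carrier)
    (a : (W : C) ⟶ (f.dom : C)) (b : (W : C) ⟶ (g.dom : C)) (ha : a ≫ f.dom.arrow = W.arrow)
    (hb : b ≫ g.dom.arrow = W.arrow) (h : a ≫ f.hom = b ≫ g.hom) : Rel f g := by
  refine ⟨W, hW, Subobject.le_of_comm a ha, Subobject.le_of_comm b hb, ?_⟩
  rw [show Subobject.ofLE W f.dom (Subobject.le_of_comm a ha) = a from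
    Subobject.eq_of_comp_arrow_eq (by simp [ha]),
    show Subobject.ofLE W g.dom (Subobject.le_of_comm b hb) = b from
    Subobject.eq_of_comp_arrow_eq (by simp [hb]), h]

theorem rel_equivalence : Equivalence (Rel (p := p) (Y := Y)) where
  refl f := ⟨f.dom, f.dom_mem, le_rfl, le_rfl, rfl⟩
  symm := by
    rintro f g ⟨W, hW, hf, hg, h⟩
    exact ⟨W, hW, hg, hf, h.symm⟩
  trans := by
    rintro f g k ⟨W, hW, hf, hg, h⟩ ⟨W', hW', hg', hk, h'⟩
    refine ⟨W ⊓ W', p.inf_mem hW hW', inf_le_left.trans hf, inf_le_right.trans hk, ?_⟩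
    rw [← Subobject.ofLE_comp_ofLE _ _ _ inf_le_left hf, Category.assoc, h,
      ← Subobject.ofLE_comp_ofLE _ _ _ inf_le_right hk, Category.assoc, ← h',
      Subobject.ofLE_comp_ofLE_assoc, Subobject.ofLE_comp_ofLE_assoc]

instance setoid (p : BooleanType X) (Y : C) : Setoid (PartialMap p Y) := ⟨Rel, rel_equivalence⟩

/-- The preimage of a subobject under a partial map, as a subobject of `X`. -/
noncomputable def preimage (f : PartialMap p Y) (V : Subobject Y) : Subobject X :=
  (Subobject.map f.dom.arrow).obj ((Subobject.pullback f.hom).obj V)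

theorem factors_preimage (f : PartialMap p Y) (V : Subobject Y) {T : C} (k : T ⟶ (f.dom : C))
    (h : V.Factors (k ≫ f.hom)) : (f.preimage V).Factors (k ≫ f.dom.arrow) := by
  have h' := Limits.pullback_factors f.hom V k h
  unfold preimage
  rw [show (Subobject.pullback f.hom).obj V =
    Subobject.mk ((Subobject.pullback f.hom).obj V).arrow from (Subobject.mk_arrow _).symm,
    Subobject.map_mk, Subobject.mk_factors_iff]
  exact ⟨Subobject.factorThru _ k h', by simp⟩

theorem preimage_le (f : PartialMap p Y) (V : Subobject Y) : f.preimage V ≤ f.dom := by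
  refine ((Subobject.mapPullbackAdj f.dom.arrow).gc _ _).mpr ?_
  rw [pullback_arrow_self f.dom]
  exact le_top

theorem factors_restrict (f : PartialMap p Y) (V : Subobject Y) :
    V.Factors (Subobject.ofLE _ _ (f.preimage_le V) ≫ f.hom) := by
  have h : f.preimage V =
      Subobject.mk (((Subobject.pullback f.hom).obj V).arrow ≫ f.dom.arrow) := by
    unfold preimage
    conv_lhs => rw [← Subobject.mk_arrow ((Subobject.pullback f.hom).obj V)]
    rw [Subobject.map_mk]
  have e : Subobject.ofLE _ _ (f.preimage_le V) =
      Subobject.ofLEMk _ _ h.le ≫ ((Subobject.pullback f.hom).obj V).arrow :=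
    Subobject.eq_of_comp_arrow_eq (by simp)
  rw [e, Category.assoc, ← (Subobject.isPullback f.hom V).w, ← Category.assoc]
  exact Subobject.factors_comp_arrow _

/-- The restriction of a partial map to a map from the preimage of `V` to `V`. -/
noncomputable def restrict (f : PartialMap p Y) (V : Subobject Y) :
    (f.preimage V : C) ⟶ (V : C) :=
  V.factorThru (Subobject.ofLE _ _ (f.preimage_le V) ≫ f.hom) (f.factors_restrict V)

theorem restrict_arrow (f : PartialMap p Y) (V : Subobject Y) :
    f.restrict V ≫ V.arrow = Subobject.ofLE _ _ (f.preimage_le V) ≫ f.hom :=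
  Subobject.factorThru_arrow _ _ _

/-- A partial map is continuous (with respect to `q`) if preimages of members of `q` belong
to `p`. -/
def IsContinuous (f : PartialMap p Y) (q : BooleanType Y) : Prop :=
  ∀ V ∈ q.carrier, f.preimage V ∈ p.carrier

/-- The composite of partial maps, defined on the preimage of the domain of the second one. -/
noncomputable def comp (f : PartialMap p Y) {q : BooleanType Y} (hf : f.IsContinuous q)
    (g : PartialMap q Z) : PartialMap p Z where
  dom := f.preimage g.dom
  dom_mem := hf _ g.dom_mem
  hom := f.restrict g.dom ≫ g.hom

/-- A map defined on all of `X`, as a partial map. -/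
noncomputable def ofHom (p : BooleanType X) (f : X ⟶ Y) : PartialMap p Y where
  dom := ⊤
  dom_mem := p.top_mem
  hom := (⊤ : Subobject X).arrow ≫ f

/-- Postcomposition of a partial map with a map. -/
noncomputable def postcomp (f : PartialMap p Y) (g : Y ⟶ Z) : PartialMap p Z where
  dom := f.dom
  dom_mem := f.dom_mem
  hom := f.hom ≫ g

theorem Rel.postcomp {f f' : PartialMap p Y} (h : Rel f f') (g : Y ⟶ Z) :
    Rel (f.postcomp g) (f'.postcomp g) := by
  obtain ⟨W, hW, h₁, h₂, h⟩ := h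
  exact ⟨W, hW, h₁, h₂, by simp only [PartialMap.postcomp, reassoc_of% h]⟩

theorem preimage_ofHom (f : X ⟶ Y) (V : Subobject Y) :
    (ofHom p f).preimage V = (Subobject.pullback f).obj V := by
  apply le_antisymm
  · refine Subobject.le_of_comm (Subobject.factorThru _ ((ofHom p f).preimage V).arrow ?_)
      (Subobject.factorThru_arrow _ _ _)
    refine Limits.pullback_factors f V _ ?_
    have h : V.Factors (Subobject.ofLE ((ofHom p f).preimage V) ⊤ le_top ≫
        (⊤ : Subobject X).arrow ≫ f) := (ofHom p f).factors_restrict V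
    rwa [Subobject.ofLE_arrow_assoc] at h
  · refine Subobject.le_of_comm (Subobject.factorThru _ ((Subobject.pullback f).obj V).arrow ?_)
      (Subobject.factorThru_arrow _ _ _)
    have h := (ofHom p f).factors_preimage V
      (T := ((Subobject.pullback f).obj V : C)) (Subobject.ofLE _ _ le_top) ?_
    · simpa [ofHom] using h
    · simp only [ofHom]
      rw [Subobject.ofLE_arrow_assoc, ← (Subobject.isPullback f V).w]
      exact Subobject.factors_comp_arrow _

theorem isContinuous_ofHom_id (p : BooleanType X) : (ofHom p (𝟙 X)).IsContinuous p := by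
  intro V hV
  rwa [preimage_ofHom, Subobject.pullback_id]

theorem preimage_comp (f : PartialMap p Y) {q : BooleanType Y} (hf : f.IsContinuous q)
    (g : PartialMap q Z) (V : Subobject Z) :
    (f.comp hf g).preimage V = f.preimage (g.preimage V) := by
  apply le_antisymm
  · refine Subobject.le_of_comm
      (Subobject.factorThru _ ((f.comp hf g).preimage V).arrow ?_)
      (Subobject.factorThru_arrow _ _ _)
    have h₁ := (f.comp hf g).factors_restrict V
    have h₀ : (f.comp hf g).preimage V ≤ f.preimage g.dom := (f.comp hf g).preimage_le V
    have h := f.factors_preimage (g.preimage V)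
      (Subobject.ofLE _ _ (h₀.trans (f.preimage_le g.dom))) ?_
    · simpa using h
    · have h₂ := g.factors_preimage V
        (Subobject.ofLE ((f.comp hf g).preimage V) (f.preimage g.dom) h₀ ≫ f.restrict g.dom)
        (by rw [Category.assoc]; exact h₁)
      rw [Category.assoc, restrict_arrow, Subobject.ofLE_comp_ofLE_assoc] at h₂
      exact h₂
  · refine Subobject.le_of_comm
      (Subobject.factorThru _ (f.preimage (g.preimage V)).arrow ?_)
      (Subobject.factorThru_arrow _ _ _)
    have hle : f.preimage (g.preimage V) ≤ f.preimage g.dom :=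
      (Subobject.map f.dom.arrow).monotone
        ((Subobject.pullback f.hom).monotone (g.preimage_le V))
    have h := (f.comp hf g).factors_preimage V (Subobject.ofLE _ _ hle) ?_
    · simpa [comp] using h
    · have e : Subobject.ofLE _ _ hle ≫ f.restrict g.dom =
          f.restrict (g.preimage V) ≫ Subobject.ofLE _ _ (g.preimage_le V) :=
        Subobject.eq_of_comp_arrow_eq (by simp [restrict_arrow])
      simp only [comp]
      rw [reassoc_of% e]
      exact Subobject.factors_of_factors_right _ (g.factors_restrict V)

theorem IsContinuous.comp {f : PartialMap p Y} {q : BooleanType Y} (hf : f.IsContinuous q)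
    {g : PartialMap q Z} {r : BooleanType Z} (hg : g.IsContinuous r) :
    (f.comp hf g).IsContinuous r := by
  intro V hV
  rw [preimage_comp]
  exact hf _ (hg _ hV)

theorem Rel.comp {f f' : PartialMap p Y} {q : BooleanType Y} (hf : f.IsContinuous q)
    (hf' : f'.IsContinuous q) (h : Rel f f') {g g' : PartialMap q Z} (h' : Rel g g') :
    Rel (f.comp hf g) (f'.comp hf' g') := by
  obtain ⟨W, hW, h₁, h₂, h⟩ := h
  obtain ⟨V, hV, k₁, k₂, k⟩ := h'
  have mono (f : PartialMap p Y) {A B : Subobject Y} (h : A ≤ B) : f.preimage A ≤ f.preimage B :=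
    (Subobject.map f.dom.arrow).monotone ((Subobject.pullback f.hom).monotone h)
  have l₁ : W ⊓ (f.preimage V ⊓ f'.preimage V) ≤ f.preimage V :=
    inf_le_right.trans inf_le_left
  have l₂ : W ⊓ (f.preimage V ⊓ f'.preimage V) ≤ f'.preimage V :=
    inf_le_right.trans inf_le_right
  have l₃ : W ⊓ (f.preimage V ⊓ f'.preimage V) ≤ W := inf_le_left
  refine ⟨W ⊓ (f.preimage V ⊓ f'.preimage V), p.inf_mem hW (p.inf_mem (hf _ hV) (hf' _ hV)),
    l₁.trans (mono f k₁), l₂.trans (mono f' k₂), ?_⟩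
  have e₁ : Subobject.ofLE _ _ (l₁.trans (mono f k₁)) ≫ f.restrict g.dom =
      (Subobject.ofLE _ _ l₁ ≫ f.restrict V) ≫ Subobject.ofLE _ _ k₁ :=
    Subobject.eq_of_comp_arrow_eq (by simp [restrict_arrow])
  have e₂ : Subobject.ofLE _ _ (l₂.trans (mono f' k₂)) ≫ f'.restrict g'.dom =
      (Subobject.ofLE _ _ l₂ ≫ f'.restrict V) ≫ Subobject.ofLE _ _ k₂ :=
    Subobject.eq_of_comp_arrow_eq (by simp [restrict_arrow])
  have e₃ : Subobject.ofLE _ _ l₁ ≫ f.restrict V = Subobject.ofLE _ _ l₂ ≫ f'.restrict V := by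
    refine Subobject.eq_of_comp_arrow_eq ?_
    simp only [Category.assoc, restrict_arrow, Subobject.ofLE_comp_ofLE_assoc]
    rw [← Subobject.ofLE_comp_ofLE _ _ _ l₃ h₁, ← Subobject.ofLE_comp_ofLE _ _ _ l₃ h₂,
      Category.assoc, Category.assoc, h]
  simp only [PartialMap.comp]
  rw [reassoc_of% e₁, reassoc_of% e₂, k, ← reassoc_of% e₃]

theorem id_comp_rel (g : PartialMap p Y) :
    Rel ((ofHom p (𝟙 X)).comp (isContinuous_ofHom_id p) g) g := by
  have h : (ofHom p (𝟙 X)).preimage g.dom = g.dom := by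
    rw [preimage_ofHom, Subobject.pullback_id]
  refine Rel.of_hom (W := (ofHom p (𝟙 X)).preimage g.dom) (by rw [h]; exact g.dom_mem) (𝟙 _)
    ((ofHom p (𝟙 X)).restrict g.dom) (by simp [comp]) ?_ (by simp [comp])
  rw [restrict_arrow]
  change Subobject.ofLE _ _ _ ≫ (⊤ : Subobject X).arrow ≫ 𝟙 X = _
  rw [Category.comp_id]
  exact Subobject.ofLE_arrow _

theorem comp_ofHom_rel (f : PartialMap p Y) {q : BooleanType Y} (hf : f.IsContinuous q)
    (g : Y ⟶ Z) : Rel (f.comp hf (ofHom q g)) (f.postcomp g) := by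
  refine Rel.of_hom (W := f.preimage ⊤) (hf _ q.top_mem) (𝟙 _)
    (Subobject.ofLE _ _ (f.preimage_le ⊤)) (by simp [comp, ofHom]) (by simp [postcomp]) ?_
  have := f.restrict_arrow ⊤
  simp only [comp, ofHom, postcomp, Category.id_comp, reassoc_of% this]

theorem assoc_rel (f : PartialMap p Y) {q : BooleanType Y} (hf : f.IsContinuous q)
    (g : PartialMap q Z) {r : BooleanType Z} (hg : g.IsContinuous r) {T : C}
    (k : PartialMap r T) :
    Rel ((f.comp hf g).comp (hf.comp hg) k) (f.comp hf (g.comp hg k)) := by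
  have h := preimage_comp f hf g k.dom
  refine ⟨(f.comp hf g).preimage k.dom, (hf.comp hg) _ k.dom_mem, le_rfl, h.le, ?_⟩
  have e : Subobject.ofLE _ _ le_rfl ≫ (f.comp hf g).restrict k.dom =
      Subobject.ofLE _ _ h.le ≫ f.restrict (g.preimage k.dom) ≫ g.restrict k.dom := by
    refine Subobject.eq_of_comp_arrow_eq ?_
    have e' : Subobject.ofLE _ _ ((f.comp hf g).preimage_le k.dom) ≫ f.restrict g.dom =
        Subobject.ofLE _ _ h.le ≫ f.restrict (g.preimage k.dom) ≫
          Subobject.ofLE _ _ (g.preimage_le k.dom) := by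
      refine Subobject.eq_of_comp_arrow_eq ?_
      simp only [Category.assoc, restrict_arrow, Subobject.ofLE_arrow,
        Subobject.ofLE_comp_ofLE_assoc]
      refine (Category.assoc _ _ _).trans ((congrArg (_ ≫ ·) (f.restrict_arrow g.dom)).trans ?_)
      exact Subobject.ofLE_comp_ofLE_assoc ((f.comp hf g).preimage k.dom) (f.preimage g.dom) f.dom
        ((f.comp hf g).preimage_le k.dom) (f.preimage_le g.dom) f.hom
    have e₀ := (f.comp hf g).restrict_arrow k.dom
    simp only [Category.assoc, e₀, restrict_arrow]
    rw [Subobject.ofLE_refl, Category.id_comp]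
    have e'' : (_ ≫ f.restrict g.dom) ≫ g.hom = _ := congrArg (· ≫ g.hom) e'
    simp only [Category.assoc] at e''
    exact (Category.assoc _ _ _).symm.trans e''
  have e₂ : (_ ≫ (f.comp hf g).restrict k.dom) ≫ k.hom = _ := congrArg (· ≫ k.hom) e
  simp only [Category.assoc] at e₂
  exact e₂

end

variable [CoherentCategory C] {X : C} {p : BooleanType X} {Y : C}

/-- Continuity does not depend on the representative of a germ. -/
theorem Rel.isContinuous {f g : PartialMap p Y} (h : Rel f g) {q : BooleanType Y}
    (hf : f.IsContinuous q) : g.IsContinuous q := by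
  obtain ⟨W, hW, h₁, h₂, h⟩ := h
  intro V hV
  refine p.mem_of_le (p.inf_mem hW (hf V hV)) ?_
    ((p.complemented g.dom_mem).map_pullback g.hom (q.complemented hV))
  have l₁ : W ⊓ f.preimage V ≤ W := inf_le_left
  have l₂ : W ⊓ f.preimage V ≤ f.preimage V := inf_le_right
  refine Subobject.le_of_comm (Subobject.factorThru _ (W ⊓ f.preimage V).arrow ?_)
    (Subobject.factorThru_arrow _ _ _)
  have k := g.factors_preimage V (Subobject.ofLE _ _ (l₁.trans h₂)) ?_
  · simpa using k
  · rw [← Subobject.ofLE_comp_ofLE _ _ _ l₁ h₂, Category.assoc, ← h,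
      Subobject.ofLE_comp_ofLE_assoc, ← Subobject.ofLE_comp_ofLE _ _ _ l₂ (f.preimage_le V),
      Category.assoc]
    exact Subobject.factors_of_factors_right _ (f.factors_restrict V)

end PartialMap

/-- The `p`-germs of maps from `X` to `Y`. -/
def Germ [HasPullbacks C] {X : C} (p : BooleanType X) (Y : C) : Type (max u₁ v₁) :=
  Quotient (PartialMap.setoid p Y)

/-- The germ of a partial map. -/
def Germ.mk [HasPullbacks C] {X : C} {p : BooleanType X} {Y : C} (f : PartialMap p Y) :
    Germ p Y :=
  Quotient.mk (PartialMap.setoid p Y) f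

theorem Germ.sound [HasPullbacks C] {X : C} {p : BooleanType X} {Y : C} {f g : PartialMap p Y}
    (h : PartialMap.Rel f g) : Germ.mk f = Germ.mk g :=
  Quotient.sound (s := PartialMap.setoid p Y) h

theorem Germ.ind [HasPullbacks C] {X : C} {p : BooleanType X} {Y : C} {P : Germ p Y → Prop}
    (h : ∀ f : PartialMap p Y, P (Germ.mk f)) (g : Germ p Y) : P g :=
  Quotient.ind (s := PartialMap.setoid p Y) h g

variable [CoherentCategory C]

namespace Germ

variable {X : C} {p : BooleanType X} {Y Z : C} {q : BooleanType Y} {r : BooleanType Z}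

/-- A germ is continuous if some, equivalently every, representative is. -/
def IsContinuous (g : Germ p Y) (q : BooleanType Y) : Prop :=
  Quotient.lift (s := PartialMap.setoid p Y) (fun f => f.IsContinuous q)
    (fun f f' (h : PartialMap.Rel f f') => propext ⟨h.isContinuous,
      (PartialMap.rel_equivalence.symm h).isContinuous⟩) g

/-- The germ of a map defined on all of `X`. -/
noncomputable def ofHom (p : BooleanType X) (f : X ⟶ Y) : Germ p Y :=
  Germ.mk (PartialMap.ofHom p f)

/-- Postcomposition of germs with a map. -/
noncomputable def postcomp (g : Germ p Y) (h : Y ⟶ Z) : Germ p Z :=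
  Quotient.lift (s := PartialMap.setoid p Y) (fun f => Germ.mk (f.postcomp h))
    (fun f f' (e : PartialMap.Rel f f') => Germ.sound (e.postcomp h)) g

/-- Composition of a continuous partial map with a germ. -/
noncomputable def compAux (f : PartialMap p Y) (hf : f.IsContinuous q) (h : Germ q Z) :
    Germ p Z :=
  Quotient.lift (s := PartialMap.setoid q Z) (fun k => Germ.mk (f.comp hf k))
    (fun k k' (e : PartialMap.Rel k k') =>
      Germ.sound (PartialMap.Rel.comp hf hf (PartialMap.rel_equivalence.refl f) e)) h

theorem compAux_congr {f f' : PartialMap p Y} (hf : f.IsContinuous q) (hf' : f'.IsContinuous q)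
    (e : PartialMap.Rel f f') (h : Germ q Z) : compAux f hf h = compAux f' hf' h := by
  induction h using Germ.ind with | _ k
  exact Germ.sound (PartialMap.Rel.comp hf hf' e (PartialMap.rel_equivalence.refl k))

/-- Composition of a continuous germ with a germ. -/
noncomputable def comp (g : Germ p Y) (hg : g.IsContinuous q) (h : Germ q Z) : Germ p Z :=
  Quotient.hrecOn (s := PartialMap.setoid p Y)
    (motive := fun g : Germ p Y => g.IsContinuous q → Germ p Z) g
    (fun (f : PartialMap p Y) (hf : f.IsContinuous q) => compAux f hf h)
    (fun (f f' : PartialMap p Y) (e : PartialMap.Rel f f') =>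
      Function.hfunext (propext ⟨fun hf => e.isContinuous hf,
        fun hf => (PartialMap.rel_equivalence.symm e).isContinuous hf⟩)
        fun hf hf' _ => heq_of_eq (compAux_congr hf hf' e h)) hg

theorem comp_mk (f : PartialMap p Y) (hf : f.IsContinuous q) (k : PartialMap q Z) :
    (Germ.mk f).comp hf (Germ.mk k) = Germ.mk (f.comp hf k) := rfl

theorem postcomp_mk (f : PartialMap p Y) (h : Y ⟶ Z) :
    (Germ.mk f).postcomp h = Germ.mk (f.postcomp h) := rfl

theorem isContinuous_comp {g : Germ p Y} (hg : g.IsContinuous q) {h : Germ q Z}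
    (hh : h.IsContinuous r) : (g.comp hg h).IsContinuous r := by
  induction g using Germ.ind with | _ f
  induction h using Germ.ind with | _ k
  exact PartialMap.IsContinuous.comp (f := f) (g := k) hg hh

theorem isContinuous_id (p : BooleanType X) : (ofHom p (𝟙 X)).IsContinuous p :=
  PartialMap.isContinuous_ofHom_id p

theorem isContinuous_ofHom (p : BooleanType X) (f : X ⟶ Y) :
    (ofHom p f).IsContinuous (p.pushforward f) := by
  intro V hV
  rw [PartialMap.preimage_ofHom]
  exact hV.2

theorem id_comp (h : Germ p Y) : (ofHom p (𝟙 X)).comp (isContinuous_id p) h = h := by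
  induction h using Germ.ind with | _ k
  exact Germ.sound (PartialMap.id_comp_rel k)

theorem comp_ofHom (g : Germ p Y) (hg : g.IsContinuous q) (h : Y ⟶ Z) :
    g.comp hg (ofHom q h) = g.postcomp h := by
  induction g using Germ.ind with | _ f
  exact Germ.sound (PartialMap.comp_ofHom_rel f hg h)

theorem postcomp_id (g : Germ p Y) : g.postcomp (𝟙 Y) = g := by
  induction g using Germ.ind with | _ f
  rw [postcomp_mk]
  simp [PartialMap.postcomp]

theorem postcomp_comp {T : C} (g : Germ p Y) (h : Y ⟶ Z) (k : Z ⟶ T) :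
    g.postcomp (h ≫ k) = (g.postcomp h).postcomp k := by
  induction g using Germ.ind with | _ f
  rw [postcomp_mk, postcomp_mk, postcomp_mk]
  simp [PartialMap.postcomp]

theorem assoc {T : C} (g : Germ p Y) (hg : g.IsContinuous q) (h : Germ q Z)
    (hh : h.IsContinuous r) (k : Germ r T) :
    (g.comp hg h).comp (isContinuous_comp hg hh) k = g.comp hg (h.comp hh k) := by
  induction g using Germ.ind with | _ f
  induction h using Germ.ind with | _ f'
  induction k using Germ.ind with | _ f''
  exact Germ.sound (PartialMap.assoc_rel f hg f' hh f'')

theorem comp_postcomp {T : C} (g : Germ p Y) (hg : g.IsContinuous q) (h : Germ q Z) (k : Z ⟶ T) :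
    (g.comp hg h).postcomp k = g.comp hg (h.postcomp k) := by
  induction g using Germ.ind with | _ f
  induction h using Germ.ind with | _ f'
  change Germ.mk ((f.comp hg f').postcomp k) = Germ.mk (f.comp hg (f'.postcomp k))
  simp [PartialMap.postcomp, PartialMap.comp]

end Germ

end Germs

/-! ### The category of ultrafilters and its topology -/

/-- The objects `(x, p)` of the category of ultrafilters on `C`. -/
structure BooleanSpec (C : Type u₁) [Category.{v₁} C] [CoherentCategory C] where
  obj : C
  type : BooleanType obj

section Spec

variable {C : Type u₁} [Category.{v₁} C] [CoherentCategory C]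

/-- Morphisms `(x, p) ⟶ (y, q)` are the continuous `p`-germs of maps from `x` to `y`. -/
noncomputable instance : Category (BooleanSpec C) where
  Hom A B := {g : Germ A.type B.obj // g.IsContinuous B.type}
  id A := ⟨Germ.ofHom A.type (𝟙 A.obj), Germ.isContinuous_id A.type⟩
  comp g h := ⟨g.1.comp g.2 h.1, Germ.isContinuous_comp g.2 h.2⟩
  id_comp g := Subtype.ext (Germ.id_comp g.1)
  comp_id g := Subtype.ext ((Germ.comp_ofHom g.1 g.2 (𝟙 _)).trans (Germ.postcomp_id g.1))
  assoc g h k := Subtype.ext (Germ.assoc g.1 g.2 h.1 h.2 k.1)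

/-- The arrow `[f] : (x, p) ⟶ (y, q)` given by `f : x ⟶ y` with `f_! p = q`. -/
noncomputable def BooleanSpec.homOfEq {X Y : C} (f : X ⟶ Y) (p : BooleanType X)
    (q : BooleanType Y) (h : p.pushforward f = q) :
    (BooleanSpec.mk X p) ⟶ (BooleanSpec.mk Y q) :=
  ⟨Germ.ofHom p f, h ▸ Germ.isContinuous_ofHom p f⟩

/-- The family of all arrows `[f] : (x, p) ⟶ (y, q)` with `f_! p = q`, for a fixed `f : x ⟶ y`. -/
noncomputable def BooleanSpec.family {X Y : C} (f : X ⟶ Y) (q : BooleanType Y) :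
    Presieve (BooleanSpec.mk Y q) :=
  Presieve.ofArrows (fun p : {p : BooleanType X // p.pushforward f = q} => BooleanSpec.mk X p.1)
    (fun p => BooleanSpec.homOfEq f p.1 q p.2)

/-- The collection `E` of the families above where `f` is an effective epimorphism. -/
noncomputable def BooleanSpec.precoverageE (C : Type u₁) [Category.{v₁} C] [CoherentCategory C] :
    Precoverage (BooleanSpec C) where
  coverings B := {R | ∃ (X : C) (f : X ⟶ B.obj), EffectiveEpi f ∧ R = BooleanSpec.family f B.type}

/-- The Grothendieck topology generated by `E`. -/
noncomputable def BooleanSpec.topologyE (C : Type u₁) [Category.{v₁} C] [CoherentCategory C] :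
    GrothendieckTopology (BooleanSpec C) :=
  (BooleanSpec.precoverageE C).toGrothendieck

/-- The functor sending `y` to the presheaf of germs `(x, p) ↦ {p-germs of maps from x to y}`. -/
noncomputable def germPresheaf (C : Type u₁) [Category.{v₁} C] [CoherentCategory C] :
    C ⥤ (BooleanSpec C)ᵒᵖ ⥤ Type (max u₁ v₁) where
  obj Y :=
    { obj := fun A => Germ A.unop.type Y
      map := fun g => ↾(fun h => g.unop.1.comp g.unop.2 h)
      map_id := fun A => by ext h; exact Germ.id_comp h
      map_comp := fun g g' => by
        ext h; exact Germ.assoc g'.unop.1 g'.unop.2 g.unop.1 g.unop.2 h }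
  map k :=
    { app := fun A => ↾(fun h => h.postcomp k)
      naturality := fun A B g => by ext h; exact Germ.comp_postcomp g.unop.1 g.unop.2 h k }
  map_id Y := by ext A h; exact Germ.postcomp_id h
  map_comp k l := by ext A h; exact Germ.postcomp_comp h k l

end Spec

/-- The topos of sheaves on the category of ultrafilters. -/
abbrev TypeTopos (C : Type u) [SmallCategory C] [CoherentCategory C] : Type (u + 1) :=
  Sheaf (BooleanSpec.topologyE C) (Type u)

/-- The functor sending `y` to the sheafification of the presheaf of germs. -/
noncomputable def typeModel (C : Type u) [SmallCategory C] [CoherentCategory C] :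
    C ⥤ TypeTopos C :=
  germPresheaf C ⋙ presheafToSheaf (BooleanSpec.topologyE C) (Type u)

/-! ### Grothendieck toposes -/

/-- A Grothendieck topos (relative to the universe `u`): a category equivalent to the category of
sheaves of sets on a small site. -/
def IsGrothendieckTopos (E : Type w) [Category.{u} E] : Prop :=
  ∃ (S : Type u) (_ : SmallCategory S) (J : GrothendieckTopology S),
    Nonempty (E ≌ Sheaf J (Type u))

/-- An object is connected if it is not initial and has no nontrivial decomposition as a binary
coproduct. -/
structure IsConnectedObject {E : Type w} [Category.{u} E] (A : E) : Prop where
  not_isInitial : IsEmpty (IsInitial A)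
  indecomposable {B₁ B₂ : E} (i₁ : B₁ ⟶ A) (i₂ : B₂ ⟶ A) :
    IsColimit (BinaryCofan.mk i₁ i₂) → Nonempty (IsInitial B₁) ∨ Nonempty (IsInitial B₂)

/-- Every object is a (small, possibly empty) coproduct of connected objects. Coproducts in a
Grothendieck topos are automatically disjoint. -/
def IsLocallyConnectedTopos (E : Type w) [Category.{u} E] : Prop :=
  ∀ X : E, ∃ (ι : Type u) (A : ι → E) (i : ∀ k, A k ⟶ X),
    (∀ k, IsConnectedObject (A k)) ∧ Nonempty (IsColimit (Cofan.mk X i))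

/-- The property of being lex and cocontinuous (preserving all small colimits). -/
def lexCocontinuous (D : Type u₁) [Category.{u} D] (E : Type w) [Category.{u} E] :
    ObjectProperty (D ⥤ E) :=
  fun M => PreservesFiniteLimits M ∧ PreservesColimitsOfSize.{u, u} M

/-- The property of being coherent. -/
def coherentFunctors (C : Type u₁) [Category.{u} C] (E : Type w) [Category.{u} E] :
    ObjectProperty (C ⥤ E) :=
  fun F => IsCoherentFunctor F

/-- Precomposition with `φ`, as a functor from the category of lex cocontinuous functors `D ⥤ E`
to the category of coherent functors `C ⥤ E`, given that it takes values in the latter. -/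
def precompose {C : Type u₁} [Category.{u} C] {D : Type u₂} [Category.{u} D] (φ : C ⥤ D)
    {E : Type w} [Category.{u} E]
    (h : ∀ M : D ⥤ E, lexCocontinuous D E M → coherentFunctors C E (φ ⋙ M)) :
    (lexCocontinuous D E).FullSubcategory ⥤ (coherentFunctors C E).FullSubcategory :=
  (coherentFunctors C E).lift
    ((lexCocontinuous D E).ι ⋙ (Functor.whiskeringLeft C D E).obj φ)
    (fun M => h M.obj M.property)

/-!
# The topos of ultrafilters of a coherent category

Write `φ` for `typeModel C`. For a left exact functor `F` from `C` to sheaves on a site, a section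
of `F X` *realises* an ultrafilter `p` on `X` if it lies in `F V` for all `V` in `p`. The whole
proof is about the property `LocallyRealises F`: every section realises some ultrafilter locally,
and `F` sends the bottom subobjects to the initial sheaf.

*Coherence of `φ`.* The presheaf of germs is left exact in the target. A germ with values in `Y`
is continuous for some ultrafilter on `Y`, so it lifts through one of two complementary
subobjects, and it lifts along effective epimorphisms after passing to a cover in `E`. For an
arbitrary union one reduces to complementary subobjects: in the Boolean case by a complement inside
the union, in the case of disjoint coproducts because a union is an effective image of a coproduct.

*Full faithfulness.* The sheaf of germs with values in `X` is covered by the sheaves represented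
by the `(X, p)`. Hence `φ ⋙ M` realises ultrafilters locally if `M` is lex cocontinuous, and `M`
sends the sheaf represented by `(X, p)` to the sheaf of realisers of `p`
(`isIso_realisersComparison`). Sheaves of realisers are functorial in natural transformations of
functors on `C`, and a cocontinuous functor on a topos is determined by its values on the site.

*Essential surjectivity.* If `F` realises ultrafilters locally, then `(X, p) ↦ {realisers of p}` is
locally flat (`LocallyRealises.isLocallyFlat`), so that by Diaconescu's argument its cocontinuous
extension to presheaves is left exact (`IsLocallyFlat.preservesFiniteLimits`). If moreover `F`
preserves effective epimorphisms, then the extension factors through sheaves for the topology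
`E` (`LocallyRealises.isSheaf_presheafRestriction`), and restricting it along `φ` gives back `F`, as
evaluation of germs at realisers is locally bijective (`LocallyRealises.isIso_evalGerms`).
A coherent functor to a locally connected topos realises ultrafilters locally: a map `a` from a
connected object to `F X` factors through exactly one of `F V` and `F W` for complementary `V`
and `W`, so the `V` such that `a` factors through `F V` form an ultrafilter (`connectedType`).
-/

/-! ### Ultrafilters, restriction and germs -/

section Ultrafilters

variable {C : Type u₁} [Category.{v₁} C] [CoherentCategory C]

/-- A subobject disjoint from the first of two subobjects with union `⊤` lies in the second. -/
theorem le_of_isLUB_of_isBot_inf {X : C} {S T R : Subobject X} (h : IsLUB {S, T} ⊤)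
    (hR : IsBot (R ⊓ S)) : R ≤ T := by
  have h₁ := CoherentCategory.isLUB_pullback R.arrow h
  rw [Subobject.pullback_top] at h₁
  have h₂ : (⊤ : Subobject (R : C)) ≤ (Subobject.pullback R.arrow).obj T := by
    refine h₁.2 ?_
    rintro _ (rfl | rfl)
    · have hb := CoherentCategory.isBot_pullback R.arrow hR
        ((Subobject.pullback R.arrow).obj T)
      rwa [Subobject.inf_pullback, pullback_arrow_self, top_inf_eq] at hb
    · exact le_rfl
  have h₃ := ((Subobject.mapPullbackAdj R.arrow).gc _ _).mpr h₂
  rwa [Subobject.map_top, Subobject.mk_arrow] at h₃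

theorem isBot_top_of_isBot {X : C} {B : Subobject X} (hB : IsBot B) :
    IsBot (⊤ : Subobject (B : C)) := by
  rw [← pullback_arrow_self]
  exact CoherentCategory.isBot_pullback _ hB

theorem BooleanType.eq_of_le {X : C} {p q : BooleanType X} (h : p.carrier ⊆ q.carrier) :
    p = q := by
  ext S
  refine ⟨fun hS => h hS, fun hS => ?_⟩
  obtain ⟨T, hT⟩ := q.complemented hS
  refine (p.mem_or_mem hT).resolve_right fun hT' => ?_
  exact q.not_mem_of_isBot hT.1 (q.inf_mem hS (h hT'))

/-- Distinct ultrafilters are separated by a complementary pair of subobjects. -/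
theorem BooleanType.exists_isComplement_of_ne {X : C} {p q : BooleanType X} (h : p ≠ q) :
    ∃ S ∈ p.carrier, ∃ T ∈ q.carrier, IsComplement S T := by
  by_contra! hc
  refine h (BooleanType.eq_of_le fun S hS => ?_)
  obtain ⟨T, hT⟩ := p.complemented hS
  exact (q.mem_or_mem hT).resolve_right fun hT' => hc S hS T hT' hT

theorem isComplementedSubobject_top (X : C) : IsComplementedSubobject (⊤ : Subobject X) := by
  obtain ⟨B, hB⟩ := CoherentCategory.exists_isBot X
  exact ⟨B, by rwa [top_inf_eq], fun _ _ => le_top, fun U hU => hU (Or.inl rfl)⟩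

theorem IsComplementedSubobject.map_arrow {X : C} {P : Subobject X}
    (hP : IsComplementedSubobject P) {S : Subobject (P : C)} (hS : IsComplementedSubobject S) :
    IsComplementedSubobject ((Subobject.map P.arrow).obj S) := by
  have := hP.map_pullback (𝟙 _) hS
  rwa [Subobject.pullback_id] at this

/-- The restriction of an ultrafilter to one of its members. -/
def BooleanType.restrict {X : C} (p : BooleanType X) (P : Subobject X) (hP : P ∈ p.carrier) :
    BooleanType (P : C) where
  carrier := {S | IsComplementedSubobject S ∧ (Subobject.map P.arrow).obj S ∈ p.carrier}
  complemented h := h.1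
  top_mem := ⟨isComplementedSubobject_top _, by rwa [Subobject.map_top, Subobject.mk_arrow]⟩
  inf_mem := by
    rintro S T ⟨hS, hS'⟩ ⟨hT, hT'⟩
    refine ⟨?_, by rw [Subobject.inf_map]; exact p.inf_mem hS' hT'⟩
    rw [Subobject.inf_eq_map_pullback]
    exact hS.map_arrow (hT.pullback S.arrow)
  mem_of_le := by
    rintro S T ⟨hS, hS'⟩ hST hT
    exact ⟨hT, p.mem_of_le hS' ((Subobject.map P.arrow).monotone hST)
      ((p.complemented hP).map_arrow hT)⟩
  not_mem_of_isBot hS h := p.not_mem_of_isBot (isBot_map_arrow P hS) h.2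
  mem_or_mem {S T} h := by
    have hS : IsComplementedSubobject S := ⟨T, h⟩
    have hT : IsComplementedSubobject T := ⟨S, h.symm⟩
    have hM := (p.complemented hP).map_arrow hS
    obtain ⟨Q, hQ⟩ := hM
    refine (p.mem_or_mem hQ).imp (fun h' => ⟨hS, h'⟩) fun h' => ⟨hT, ?_⟩
    refine p.mem_of_le (p.inf_mem hP h') ?_ ((p.complemented hP).map_arrow hT)
    rw [Subobject.inf_eq_map_pullback]
    refine (Subobject.map P.arrow).monotone (le_of_isLUB_of_isBot_inf h.2 ?_)
    have hb := CoherentCategory.isBot_pullback P.arrow hQ.symm.1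
    rwa [Subobject.inf_pullback, Subobject.pullback_map_self] at hb

theorem BooleanType.not_isBot_top {X : C} (p : BooleanType X) : ¬ IsBot (⊤ : Subobject X) :=
  fun h => p.not_mem_of_isBot h p.top_mem

end Ultrafilters

namespace Germ

section

variable {C : Type u₁} [Category.{v₁} C] [CoherentCategory C] {X : C} {p : BooleanType X}
  {Y Z : C} {q : BooleanType Y}

/-- The germ of the identity, as a germ with values in a member of the ultrafilter. -/
noncomputable def toMem (p : BooleanType X) (P : Subobject X) (hP : P ∈ p.carrier) :
    Germ p (P : C) :=
  Germ.mk ⟨P, hP, 𝟙 _⟩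

theorem toMem_postcomp (f : PartialMap p Y) :
    (toMem p f.dom f.dom_mem).postcomp f.hom = Germ.mk f := by
  rw [toMem, postcomp_mk]
  simp [PartialMap.postcomp]

theorem ofHom_postcomp (f : X ⟶ Y) (g : Y ⟶ Z) :
    (ofHom p f).postcomp g = ofHom p (f ≫ g) := by
  rw [ofHom, postcomp_mk]
  simp [PartialMap.postcomp, PartialMap.ofHom, ofHom]

theorem toMem_postcomp_arrow (P : Subobject X) (hP : P ∈ p.carrier) :
    (toMem p P hP).postcomp P.arrow = ofHom p (𝟙 X) :=
  Germ.sound ⟨P, hP, le_rfl, le_top, by simp [PartialMap.postcomp, PartialMap.ofHom]⟩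

theorem isContinuous_toMem (P : Subobject X) (hP : P ∈ p.carrier) :
    (toMem p P hP).IsContinuous (p.restrict P hP) := by
  intro V hV
  have := hV.2
  change (Subobject.map P.arrow).obj ((Subobject.pullback (𝟙 _)).obj V) ∈ _
  rwa [Subobject.pullback_id]

theorem exact {f g : PartialMap p Y} (h : Germ.mk f = Germ.mk g) : PartialMap.Rel f g :=
  Quotient.exact (s := PartialMap.setoid p Y) h

/-- A germ with values in `Y` is determined by its composites with a jointly monic pair of maps out
of `Y`. -/
theorem ext_of_jointly_mono {Z₁ Z₂ : C} (a : Y ⟶ Z₁) (b : Y ⟶ Z₂)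
    (h : ∀ ⦃T : C⦄ (k l : T ⟶ Y), k ≫ a = l ≫ a → k ≫ b = l ≫ b → k = l) {g g' : Germ p Y}
    (ha : g.postcomp a = g'.postcomp a) (hb : g.postcomp b = g'.postcomp b) : g = g' := by
  induction g using Germ.ind with | _ f
  induction g' using Germ.ind with | _ f'
  obtain ⟨W, hW, (h₁ : W ≤ f.dom), (h₂ : W ≤ f'.dom), e⟩ := exact ha
  obtain ⟨W', hW', (h₁' : W' ≤ f.dom), (h₂' : W' ≤ f'.dom), e'⟩ := exact hb
  have l₁ : W ⊓ W' ≤ W := inf_le_left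
  have l₂ : W ⊓ W' ≤ W' := inf_le_right
  refine Germ.sound ⟨W ⊓ W', p.inf_mem hW hW', l₁.trans h₁, l₁.trans h₂, h _ _ ?_ ?_⟩
  · have := congrArg (Subobject.ofLE _ _ l₁ ≫ ·) e
    simpa [PartialMap.postcomp] using this
  · have := congrArg (Subobject.ofLE _ _ l₂ ≫ ·) e'
    simpa [PartialMap.postcomp] using this

theorem postcomp_injective (m : Y ⟶ Z) [Mono m] :
    Function.Injective (fun g : Germ p Y => g.postcomp m) := fun _ _ h =>
  ext_of_jointly_mono m m (fun _ _ _ e _ => (cancel_mono m).1 e) h h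

theorem eq_of_isTerminal (hY : IsTerminal Y) (g g' : Germ p Y) : g = g' := by
  induction g using Germ.ind with | _ f
  induction g' using Germ.ind with | _ f'
  exact Germ.sound ⟨f.dom ⊓ f'.dom, p.inf_mem f.dom_mem f'.dom_mem, inf_le_left, inf_le_right,
    hY.hom_ext _ _⟩

theorem exists_lift_of_isPullback {P Y₁ Y₂ : C} {fst : P ⟶ Y₁} {snd : P ⟶ Y₂} {f : Y₁ ⟶ Z}
    {g : Y₂ ⟶ Z} (h : IsPullback fst snd f g) (a : Germ p Y₁) (b : Germ p Y₂)
    (e : a.postcomp f = b.postcomp g) :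
    ∃ c : Germ p P, c.postcomp fst = a ∧ c.postcomp snd = b := by
  induction a using Germ.ind with | _ a
  induction b using Germ.ind with | _ b
  obtain ⟨W, hW, h₁, h₂, e⟩ := exact e
  refine ⟨Germ.mk ⟨W, hW, h.lift (Subobject.ofLE _ _ h₁ ≫ a.hom) (Subobject.ofLE _ _ h₂ ≫ b.hom)
    (by simpa [PartialMap.postcomp] using e)⟩, Germ.sound ⟨W, hW, le_rfl, h₁, ?_⟩,
    Germ.sound ⟨W, hW, le_rfl, h₂, ?_⟩⟩
  · simpa [PartialMap.postcomp] using h.lift_fst _ _ _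
  · simpa [PartialMap.postcomp] using h.lift_snd _ _ _

/-- A continuous germ takes values in every member of the target ultrafilter. -/
theorem exists_lift_of_isContinuous {g : Germ p Y} (hg : g.IsContinuous q) {V : Subobject Y}
    (hV : V ∈ q.carrier) : ∃ g' : Germ p (V : C), g'.postcomp V.arrow = g := by
  refine ⟨g.comp hg (toMem q V hV), ?_⟩
  rw [comp_postcomp, toMem_postcomp_arrow, comp_ofHom, postcomp_id]

theorem exists_isContinuous (g : Germ p Y) : ∃ q : BooleanType Y, g.IsContinuous q := by
  induction g using Germ.ind with | _ f
  refine ⟨(p.restrict f.dom f.dom_mem).pushforward f.hom, ?_⟩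
  rw [← toMem_postcomp, ← comp_ofHom _ (isContinuous_toMem f.dom f.dom_mem)]
  exact isContinuous_comp _ (isContinuous_ofHom _ _)

end

end Germ

/-! ### Elements realising an ultrafilter -/

theorem injective_map_of_mono {C : Type u₁} [Category.{v₁} C] (H : C ⥤ Type w)
    [H.PreservesMonomorphisms] {Y Z : C} (m : Y ⟶ Z) [Mono m] : Function.Injective (H.map m) :=
  (mono_iff_injective _).1 inferInstance

section Realisers

variable {C : Type u₁} [Category.{v₁} C] [CoherentCategory C] {X : C}

/-- The elements of `H X` which belong to `H V` for every member `V` of the ultrafilter `p`, for a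
functor `H : C ⥤ Type w`. -/
def BooleanType.realisers (p : BooleanType X) (H : C ⥤ Type w) : Set (H.obj X) :=
  {a | ∀ V ∈ p.carrier, ∃ b : H.obj (V : C), H.map V.arrow b = a}

theorem BooleanType.app_mem_realisers {H : C ⥤ Type w} {H' : C ⥤ Type w}
    (τ : H ⟶ H') {p : BooleanType X} {a : H.obj X}
    (ha : a ∈ p.realisers H) : τ.app X a ∈ p.realisers H' := by
  intro V hV
  obtain ⟨b, rfl⟩ := ha V hV
  exact ⟨τ.app _ b, (NatTrans.naturality_apply τ _ _).symm⟩

namespace Germ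

variable {p : BooleanType X} {Y Z : C} {q : BooleanType Y} (H : C ⥤ Type w)
  [H.PreservesMonomorphisms]

/-- The value of a `p`-germ of maps from `X` to `Y` at an element of `H X` realising `p`. -/
noncomputable def eval (g : Germ p Y) (a : p.realisers H) : H.obj Y :=
  Quotient.lift (s := PartialMap.setoid p Y)
    (fun f => H.map f.hom (a.2 f.dom f.dom_mem).choose)
    (by
      rintro f f' ⟨W, hW, h₁, h₂, e⟩
      obtain ⟨b, hb⟩ := a.2 W hW
      have k₁ : (a.2 f.dom f.dom_mem).choose = H.map (Subobject.ofLE _ _ h₁) b := by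
        apply injective_map_of_mono H f.dom.arrow
        rw [(a.2 f.dom f.dom_mem).choose_spec, ← hb, ← Functor.map_comp_apply,
          Subobject.ofLE_arrow]
      have k₂ : (a.2 f'.dom f'.dom_mem).choose = H.map (Subobject.ofLE _ _ h₂) b := by
        apply injective_map_of_mono H f'.dom.arrow
        rw [(a.2 f'.dom f'.dom_mem).choose_spec, ← hb, ← Functor.map_comp_apply,
          Subobject.ofLE_arrow]
      simp only [k₁, k₂, ← Functor.map_comp_apply, e]) g

theorem eval_mk (f : PartialMap p Y) (a : p.realisers H) (b : H.obj (f.dom : C))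
    (hb : H.map f.dom.arrow b = a.1) : (Germ.mk f).eval H a = H.map f.hom b := by
  have : (a.2 f.dom f.dom_mem).choose = b := by
    apply injective_map_of_mono H f.dom.arrow
    rw [(a.2 f.dom f.dom_mem).choose_spec, hb]
  change H.map f.hom (a.2 f.dom f.dom_mem).choose = _
  rw [this]

theorem eval_postcomp (g : Germ p Y) (f : Y ⟶ Z) (a : p.realisers H) :
    (g.postcomp f).eval H a = H.map f (g.eval H a) := by
  induction g using Germ.ind with | _ k
  obtain ⟨b, hb⟩ := a.2 k.dom k.dom_mem
  rw [postcomp_mk, eval_mk H k a b hb]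
  have := eval_mk H (k.postcomp f) a b hb
  rw [this, ← Functor.map_comp_apply]
  rfl

theorem eval_ofHom (f : X ⟶ Y) (a : p.realisers H) : (ofHom p f).eval H a = H.map f a.1 := by
  obtain ⟨b, hb⟩ := a.2 ⊤ p.top_mem
  have := eval_mk H (PartialMap.ofHom p f) a b hb
  rw [ofHom, this, ← hb, ← Functor.map_comp_apply]
  rfl

theorem eval_mem_realisers {g : Germ p Y} (hg : g.IsContinuous q) (a : p.realisers H) :
    g.eval H a ∈ q.realisers H := by
  intro V hV
  obtain ⟨g', rfl⟩ := exists_lift_of_isContinuous hg hV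
  exact ⟨g'.eval H a, (eval_postcomp H g' _ a).symm⟩

theorem eval_comp (g : Germ p Y) (hg : g.IsContinuous q) (h : Germ q Z) (a : p.realisers H) :
    (g.comp hg h).eval H a = h.eval H ⟨g.eval H a, eval_mem_realisers H hg a⟩ := by
  induction h using Germ.ind with | _ k
  rw [eval_mk H k _ ((g.comp hg (toMem q k.dom k.dom_mem)).eval H a), ← eval_postcomp,
    comp_postcomp, toMem_postcomp]
  rw [← eval_postcomp, comp_postcomp, toMem_postcomp_arrow, comp_ofHom, postcomp_id]

theorem eval_naturality {H' : C ⥤ Type w} [H'.PreservesMonomorphisms] (τ : H ⟶ H') (g : Germ p Y)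
    (a : p.realisers H) :
    τ.app Y (g.eval H a) = g.eval H' ⟨τ.app X a.1, BooleanType.app_mem_realisers τ a.2⟩ := by
  induction g using Germ.ind with | _ f
  obtain ⟨b, hb⟩ := a.2 f.dom f.dom_mem
  rw [eval_mk H f a b hb, eval_mk H' f _ (τ.app _ b), NatTrans.naturality_apply]
  rw [← NatTrans.naturality_apply, hb]

end Germ

/-- The image of a realiser of `p` under `f` realises the image ultrafilter. -/
theorem BooleanType.map_mem_realisers_pushforward {p : BooleanType X} {Y : C} (H : C ⥤ Type w)
    [H.PreservesMonomorphisms] (f : X ⟶ Y) {a : H.obj X} (ha : a ∈ p.realisers H) :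
    H.map f a ∈ (p.pushforward f).realisers H := by
  have := Germ.eval_mem_realisers H (Germ.isContinuous_ofHom p f) ⟨a, ha⟩
  rwa [Germ.eval_ofHom] at this

end Realisers

/-! ### Left exactness from pullback squares -/

theorem preservesFiniteLimits_of_isPullback {A : Type u₁} [Category.{v₁} A] {B : Type u₂}
    [Category.{v₂} B] [HasFiniteLimits A] (F : A ⥤ B)
    (ht : Nonempty (IsTerminal (F.obj (⊤_ A))))
    (hp : ∀ {X Y Z : A} (f : X ⟶ Z) (g : Y ⟶ Z), IsPullback (F.map (pullback.fst f g))
      (F.map (pullback.snd f g)) (F.map f) (F.map g)) : PreservesFiniteLimits F := by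
  have h₁ : PreservesLimit (Functor.empty.{0} A) F :=
    preservesLimit_of_preserves_limit_cone terminalIsTerminal
      ((isLimitMapConeEmptyConeEquiv F _).symm ht.some)
  have : PreservesLimitsOfShape (Discrete PEmpty.{1}) F :=
    preservesLimitsOfShape_pempty_of_preservesTerminal F
  have : PreservesLimitsOfShape WalkingCospan F := by
    refine ⟨fun {K} => ?_⟩
    have h₂ : PreservesLimit (cospan (K.map WalkingCospan.Hom.inl)
        (K.map WalkingCospan.Hom.inr)) F :=
      preservesLimit_of_preserves_limit_cone (IsPullback.of_hasPullback _ _).isLimit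
        ((isLimitMapConePullbackConeEquiv F pullback.condition).symm (hp _ _).isLimit)
    exact preservesLimit_of_iso_diagram F (diagramIsoCospan K).symm
  exact preservesFiniteLimits_of_preservesTerminal_and_pullbacks F

/-! ### Properties that hold locally -/

section Locally

variable {S : Type u} [SmallCategory S]

/-- A property of the arrows into `s` holds locally if it holds on a covering sieve. -/
def CategoryTheory.GrothendieckTopology.Locally (J : GrothendieckTopology S) {s : S}
    (Q : ∀ ⦃t : S⦄, (t ⟶ s) → Prop) : Prop :=
  ∃ U ∈ J s, ∀ ⦃t : S⦄ (f : t ⟶ s), U.arrows f → Q f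

variable {J : GrothendieckTopology S} {s : S}

theorem CategoryTheory.GrothendieckTopology.Locally.of_forall {Q : ∀ ⦃t : S⦄, (t ⟶ s) → Prop}
    (h : ∀ ⦃t : S⦄ (f : t ⟶ s), Q f) : J.Locally Q :=
  ⟨⊤, J.top_mem s, fun _ f _ => h f⟩

theorem CategoryTheory.GrothendieckTopology.Locally.bind {Q Q' : ∀ ⦃t : S⦄, (t ⟶ s) → Prop}
    (h : J.Locally Q) (h' : ∀ ⦃t : S⦄ (f : t ⟶ s), Q f →
      J.Locally (fun _ (g : _ ⟶ t) => Q' (g ≫ f))) : J.Locally Q' := by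
  obtain ⟨U, hU, hQ⟩ := h
  choose V hV hV' using fun t (f : t ⟶ s) (hf : U f) => h' f (hQ f hf)
  refine ⟨Sieve.bind U.1 (fun t f hf => V t f hf), J.bind_covering hU (fun _ _ _ => hV _ _ _), ?_⟩
  rintro t _ ⟨r, g, f, hf, hg, rfl⟩
  exact hV' r f hf g hg

theorem CategoryTheory.GrothendieckTopology.Locally.mono {Q Q' : ∀ ⦃t : S⦄, (t ⟶ s) → Prop}
    (h : J.Locally Q) (h' : ∀ ⦃t : S⦄ (f : t ⟶ s), Q f → Q' f) : J.Locally Q' := by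
  obtain ⟨U, hU, hQ⟩ := h
  exact ⟨U, hU, fun t f hf => h' f (hQ f hf)⟩

/-- On an object with empty cover everything holds locally. -/
theorem CategoryTheory.GrothendieckTopology.Locally.of_bot_mem (h : ⊥ ∈ J s)
    {Q : ∀ ⦃t : S⦄, (t ⟶ s) → Prop} : J.Locally Q :=
  ⟨⊥, h, fun _ _ hf => hf.elim⟩

theorem isLocallyInjective_of_locally {P Q : Sᵒᵖ ⥤ Type u} (φ : P ⟶ Q)
    (h : ∀ ⦃s : S⦄ (a b : P.obj (.op s)), φ.app _ a = φ.app _ b →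
      J.Locally (fun _ f => P.map f.op a = P.map f.op b)) : Presheaf.IsLocallyInjective J φ where
  equalizerSieve_mem {s} a b e := by
    obtain ⟨U, hU, hQ⟩ := h a b e
    exact J.superset_covering (fun _ f hf => hQ f hf) hU

theorem isLocallySurjective_of_locally {P Q : Sᵒᵖ ⥤ Type u} (φ : P ⟶ Q)
    (h : ∀ ⦃s : S⦄ (b : Q.obj (.op s)), J.Locally (fun _ f => ∃ a, φ.app _ a = Q.map f.op b)) :
    Presheaf.IsLocallySurjective J φ where
  imageSieve_mem {s} b := by
    obtain ⟨U, hU, hQ⟩ := h b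
    exact J.superset_covering (fun _ f hf => hQ f hf) hU

theorem locally_exists_app_eq {P Q : Sᵒᵖ ⥤ Type u} (φ : P ⟶ Q) [Presheaf.IsLocallySurjective J φ]
    (b : Q.obj (.op s)) : J.Locally (fun _ f => ∃ a, φ.app _ a = Q.map f.op b) :=
  ⟨Presheaf.imageSieve φ b, Presheaf.imageSieve_mem J φ b, fun t f h => by
    obtain ⟨a, ha⟩ := h
    exact ⟨a, ha⟩⟩

/-- Sections of a sheaf that agree locally are equal. -/
theorem CategoryTheory.GrothendieckTopology.Locally.section_ext {F : Sheaf J (Type u)}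
    {a b : F.obj.obj (.op s)} (h : J.Locally (fun _ f => F.obj.map f.op a = F.obj.map f.op b)) :
    a = b := by
  obtain ⟨U, hU, hQ⟩ := h
  have := ((isSheaf_iff_isSheaf_of_type J F.obj).1 F.property).isSeparated U hU
  exact this.ext fun t f hf => hQ f hf

/-- A section of a sheaf which lies locally in a subsheaf lies in it. -/
theorem CategoryTheory.GrothendieckTopology.Locally.exists_app_eq {F G : Sheaf J (Type u)}
    (φ : F ⟶ G) [Mono φ] {b : G.obj.obj (.op s)}
    (h : J.Locally (fun _ f => ∃ a, φ.hom.app _ a = G.obj.map f.op b)) :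
    ∃ a, φ.hom.app _ a = b := by
  obtain ⟨U, hU, hQ⟩ := h
  have inj (t : S) : Function.Injective (φ.hom.app (.op t)) := by
    rw [← mono_iff_injective]
    have : Mono φ.hom := inferInstanceAs (Mono ((sheafToPresheaf J _).map φ))
    infer_instance
  choose a ha using hQ
  have hF := (((isSheaf_iff_isSheaf_of_type J F.obj).1 F.property) U hU)
  have hc : Presieve.FamilyOfElements.Compatible (P := F.obj) (R := U.arrows) a := by
    intro t₁ t₂ r g₁ g₂ f₁ f₂ h₁ h₂ e
    apply inj
    rw [NatTrans.naturality_apply, NatTrans.naturality_apply, ha, ha, ← Functor.map_comp_apply,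
      ← Functor.map_comp_apply, ← op_comp, ← op_comp, e]
  obtain ⟨x, hx, -⟩ := hF a hc
  refine ⟨x, Locally.section_ext ⟨U, hU, fun t f hf => ?_⟩⟩
  dsimp only
  rw [← NatTrans.naturality_apply, hx f hf, ha]

theorem isPullback_presheafToSheaf {P X Y Z : Sᵒᵖ ⥤ Type u} {fst : P ⟶ X} {snd : P ⟶ Y}
    {f : X ⟶ Z} {g : Y ⟶ Z} (w : fst ≫ f = snd ≫ g)
    (inj : ∀ ⦃s : S⦄ (a b : P.obj (.op s)), fst.app _ a = fst.app _ b → snd.app _ a = snd.app _ b →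
      J.Locally (fun _ f => P.map f.op a = P.map f.op b))
    (surj : ∀ ⦃s : S⦄ (x : X.obj (.op s)) (y : Y.obj (.op s)), f.app _ x = g.app _ y →
      J.Locally (fun _ k => ∃ a, fst.app _ a = X.map k.op x ∧ snd.app _ a = Y.map k.op y)) :
    IsPullback ((presheafToSheaf J (Type u)).map fst) ((presheafToSheaf J (Type u)).map snd)
      ((presheafToSheaf J (Type u)).map f) ((presheafToSheaf J (Type u)).map g) := by
  have hp (s : Sᵒᵖ) := (IsPullback.of_hasPullback f g).map ((evaluation _ _).obj s)
  simp only [Types.isPullback_iff] at hp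
  let κ : P ⟶ pullback f g := pullback.lift fst snd w
  have hκ₁ (s) (a : P.obj s) : (pullback.fst f g).app _ (κ.app _ a) = fst.app _ a := by
    rw [← NatTrans.comp_app_apply, pullback.lift_fst]
  have hκ₂ (s) (a : P.obj s) : (pullback.snd f g).app _ (κ.app _ a) = snd.app _ a := by
    rw [← NatTrans.comp_app_apply, pullback.lift_snd]
  have h₁ : Presheaf.IsLocallyInjective J κ := isLocallyInjective_of_locally _ fun s a b e =>
    inj a b (by rw [← hκ₁, e, hκ₁]) (by rw [← hκ₂, e, hκ₂])
  have h₂ : Presheaf.IsLocallySurjective J κ := isLocallySurjective_of_locally _ fun s z => by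
    refine (surj ((pullback.fst f g).app _ z) ((pullback.snd f g).app _ z) ?_).mono ?_
    · rw [← NatTrans.comp_app_apply, pullback.condition, NatTrans.comp_app_apply]
    · rintro t k ⟨a, ha₁, ha₂⟩
      refine ⟨a, (hp _).2.1 _ _ ⟨?_, ?_⟩⟩
      · exact (hκ₁ _ _).trans (ha₁.trans (NatTrans.naturality_apply _ _ _).symm)
      · exact (hκ₂ _ _).trans (ha₂.trans (NatTrans.naturality_apply _ _ _).symm)
  have : IsIso ((presheafToSheaf J (Type u)).map κ) := by
    rw [← GrothendieckTopology.W_iff]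
    exact J.W_of_isLocallyBijective κ
  refine IsPullback.of_iso ((IsPullback.of_hasPullback f g).map (presheafToSheaf J (Type u)))
    (asIso ((presheafToSheaf J (Type u)).map κ)).symm (Iso.refl _) (Iso.refl _) (Iso.refl _)
    ?_ ?_ (by simp) (by simp)
  · rw [Iso.symm_hom, Iso.eq_inv_comp, Iso.refl_hom, Category.comp_id, asIso_hom,
      ← Functor.map_comp]
    exact congrArg _ (pullback.lift_fst _ _ _)
  · rw [Iso.symm_hom, Iso.eq_inv_comp, Iso.refl_hom, Category.comp_id, asIso_hom,
      ← Functor.map_comp]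
    exact congrArg _ (pullback.lift_snd _ _ _)

end Locally

/-! ### Tensoring presheaves with a locally flat functor -/

section Tensor

variable {D : Type u} [SmallCategory D] {S : Type u} [SmallCategory S] (N : D ⥤ Sᵒᵖ ⥤ Type u)

/-- The relation defining the tensor product of a presheaf `P` on `D` with the sections at `s` of
a functor `N` on `D`. -/
inductive TensorRel (P : Dᵒᵖ ⥤ Type u) (s : Sᵒᵖ) :
    (Σ b : D, P.obj (.op b) × (N.obj b).obj s) → (Σ b : D, P.obj (.op b) × (N.obj b).obj s) → Prop
  | rel {b b' : D} (f : b ⟶ b') (x : P.obj (.op b')) (n : (N.obj b).obj s) :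
      TensorRel P s ⟨b, P.map f.op x, n⟩ ⟨b', x, (N.map f).app s n⟩

/-- The tensor product of a presheaf on `D` with a functor from `D` to presheaves on `S`. -/
def tensorObj (P : Dᵒᵖ ⥤ Type u) : Sᵒᵖ ⥤ Type u where
  obj s := Quot (TensorRel N P s)
  map {s t} f := ↾(Quot.map (fun z => ⟨z.1, z.2.1, (N.obj z.1).map f z.2.2⟩) (by
    rintro _ _ ⟨k, x, n⟩
    dsimp only
    rw [← NatTrans.naturality_apply]
    exact .rel k x _))
  map_id s := by
    ext ⟨b, x, n⟩
    simp [Quot.map]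
  map_comp f g := by
    ext ⟨b, x, n⟩
    simp [Quot.map]

variable {N} in
/-- The class of a pair in the tensor product. -/
def tmk {P : Dᵒᵖ ⥤ Type u} {s : Sᵒᵖ} {b : D} (x : P.obj (.op b)) (n : (N.obj b).obj s) :
    (tensorObj N P).obj s := Quot.mk _ ⟨b, x, n⟩

theorem tmk_map {P : Dᵒᵖ ⥤ Type u} {s t : Sᵒᵖ} (f : s ⟶ t) {b : D} (x : P.obj (.op b))
    (n : (N.obj b).obj s) : (tensorObj N P).map f (tmk x n) = tmk x ((N.obj b).map f n) := rfl

theorem tmk_rel {P : Dᵒᵖ ⥤ Type u} {s : Sᵒᵖ} {b b' : D} (f : b ⟶ b') (x : P.obj (.op b'))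
    (n : (N.obj b).obj s) : tmk (P.map f.op x) n = tmk (P := P) x ((N.map f).app s n) :=
  Quot.sound (.rel f x n)

/-- The tensor product as a functor of the presheaf. -/
def tensor : (Dᵒᵖ ⥤ Type u) ⥤ Sᵒᵖ ⥤ Type u where
  obj := tensorObj N
  map {P Q} φ :=
    { app s := ↾(Quot.map (fun z => ⟨z.1, φ.app _ z.2.1, z.2.2⟩) (by
        rintro _ _ ⟨k, x, n⟩
        dsimp only
        rw [NatTrans.naturality_apply]
        exact .rel k _ n))
      naturality s t f := by ext ⟨b, x, n⟩; rfl }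
  map_id P := by ext s ⟨b, x, n⟩; rfl
  map_comp f g := by ext s ⟨b, x, n⟩; rfl

/-- The right adjoint of the tensor product, sending `Q` to the presheaf `b ↦ Hom(N b, Q)`. -/
abbrev tensorRightAdjoint : (Sᵒᵖ ⥤ Type u) ⥤ Dᵒᵖ ⥤ Type u :=
  yoneda ⋙ (Functor.whiskeringLeft _ _ _).obj N.op

/-- The tensor-hom adjunction. -/
def tensorAdjunction : tensor N ⊣ tensorRightAdjoint N :=
  Adjunction.mkOfHomEquiv
    { homEquiv P Q :=
        { toFun φ :=
            { app b := ↾(fun x =>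
                { app s := ↾(fun n => φ.app s (tmk x n))
                  naturality s t f := by
                    ext n
                    exact NatTrans.naturality_apply φ f (tmk x n) })
              naturality b b' f := by
                ext x
                refine NatTrans.ext (funext fun s => ?_)
                ext n
                exact congrArg (φ.app s) (tmk_rel N f.unop x n) }
          invFun ψ :=
            { app s := ↾(Quot.lift (fun z => (ψ.app _ z.2.1).app s z.2.2) (by
                rintro _ _ ⟨k, x, n⟩
                dsimp only
                rw [NatTrans.naturality_apply]
                rfl))
              naturality s t f := by
                ext ⟨b, x, n⟩
                exact NatTrans.naturality_apply (ψ.app _ x) f n }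
          left_inv φ := by ext s ⟨b, x, n⟩; rfl
          right_inv ψ := by ext b x; rfl }
      homEquiv_naturality_left_symm f g := by ext s ⟨b, x, n⟩; rfl
      homEquiv_naturality_right f g := by ext b x; rfl }

/-- Local flatness of a functor to presheaves on a site: locally, its categories of elements are
cofiltered. -/
structure IsLocallyFlat (J : GrothendieckTopology S) : Prop where
  nonempty (s : S) : J.Locally (fun t (_ : t ⟶ s) => ∃ b, Nonempty ((N.obj b).obj (.op t)))
  directed {s : S} {b b' : D} (n : (N.obj b).obj (.op s)) (n' : (N.obj b').obj (.op s)) :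
    J.Locally (fun t (f : t ⟶ s) => ∃ (c : D) (k : c ⟶ b) (k' : c ⟶ b') (o : (N.obj c).obj (.op t)),
      (N.map k).app _ o = (N.obj b).map f.op n ∧ (N.map k').app _ o = (N.obj b').map f.op n')
  equalize {s : S} {b b' : D} (k l : b ⟶ b') (n : (N.obj b).obj (.op s))
    (h : (N.map k).app _ n = (N.map l).app _ n) :
    J.Locally (fun t (f : t ⟶ s) => ∃ (c : D) (m : c ⟶ b) (o : (N.obj c).obj (.op t)),
      m ≫ k = m ≫ l ∧ (N.map m).app _ o = (N.obj b).map f.op n)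

variable {N} {J : GrothendieckTopology S}

/-- Two elements with a common image have locally a common refinement over that image. -/
theorem IsLocallyFlat.exists_square (hN : IsLocallyFlat N J) {s : S} {b b₁ b₂ : D} (k₁ : b₁ ⟶ b)
    (k₂ : b₂ ⟶ b) (n₁ : (N.obj b₁).obj (.op s)) (n₂ : (N.obj b₂).obj (.op s))
    (h : (N.map k₁).app _ n₁ = (N.map k₂).app _ n₂) :
    J.Locally (fun t (f : t ⟶ s) => ∃ (c : D) (l₁ : c ⟶ b₁) (l₂ : c ⟶ b₂)
      (o : (N.obj c).obj (.op t)), l₁ ≫ k₁ = l₂ ≫ k₂ ∧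
      (N.map l₁).app _ o = (N.obj b₁).map f.op n₁ ∧
      (N.map l₂).app _ o = (N.obj b₂).map f.op n₂) := by
  refine (hN.directed n₁ n₂).bind ?_
  rintro t f ⟨c, l₁, l₂, o, e₁, e₂⟩
  refine (hN.equalize (l₁ ≫ k₁) (l₂ ≫ k₂) o ?_).mono ?_
  · simp only [Functor.map_comp, NatTrans.comp_app_apply, e₁, e₂, NatTrans.naturality_apply, h]
  · rintro t' g ⟨d, m, o', hm, ho⟩
    refine ⟨d, m ≫ l₁, m ≫ l₂, o', by simpa using hm, ?_, ?_⟩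
    · simp only [Functor.map_comp, NatTrans.comp_app_apply, ho, NatTrans.naturality_apply, e₁,
        op_comp, comp_apply]
    · simp only [Functor.map_comp, NatTrans.comp_app_apply, ho, NatTrans.naturality_apply, e₂,
        op_comp, comp_apply]

/-- Equality in the tensor product with a locally flat functor: locally, equal classes have a common
refinement. -/
theorem IsLocallyFlat.exists_of_tmk_eq (hN : IsLocallyFlat N J) {P : Dᵒᵖ ⥤ Type u} {s : S}
    {b₁ b₂ : D} (x₁ : P.obj (.op b₁)) (x₂ : P.obj (.op b₂)) (n₁ : (N.obj b₁).obj (.op s))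
    (n₂ : (N.obj b₂).obj (.op s)) (h : tmk x₁ n₁ = tmk x₂ n₂) :
    J.Locally (fun t (f : t ⟶ s) => ∃ (c : D) (l₁ : c ⟶ b₁) (l₂ : c ⟶ b₂)
      (o : (N.obj c).obj (.op t)), P.map l₁.op x₁ = P.map l₂.op x₂ ∧
      (N.map l₁).app _ o = (N.obj b₁).map f.op n₁ ∧
      (N.map l₂).app _ o = (N.obj b₂).map f.op n₂) := by
  have h' := Quot.eqvGen_exact h
  suffices ∀ z₁ z₂, Relation.EqvGen (TensorRel N P (.op s)) z₁ z₂ →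
      J.Locally (fun t (f : t ⟶ s) => ∃ (c : D) (l₁ : c ⟶ z₁.1) (l₂ : c ⟶ z₂.1)
        (o : (N.obj c).obj (.op t)), P.map l₁.op z₁.2.1 = P.map l₂.op z₂.2.1 ∧
        (N.map l₁).app _ o = (N.obj z₁.1).map f.op z₁.2.2 ∧
        (N.map l₂).app _ o = (N.obj z₂.1).map f.op z₂.2.2) from this _ _ h'
  intro z₁ z₂ h
  induction h with
  | rel _ _ h =>
    obtain @⟨b, b', k, x, n⟩ := h
    exact .of_forall fun t f => ⟨b, 𝟙 _, k, (N.obj b).map f.op n, by simp, by simp,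
      NatTrans.naturality_apply _ _ _⟩
  | refl z =>
    exact .of_forall fun t f => ⟨z.1, 𝟙 _, 𝟙 _, (N.obj z.1).map f.op z.2.2, by simp, by simp,
      by simp⟩
  | symm _ _ _ ih =>
    refine ih.mono ?_
    rintro t f ⟨c, l₁, l₂, o, e, e₁, e₂⟩
    exact ⟨c, l₂, l₁, o, e.symm, e₂, e₁⟩
  | trans z₁ z₂ z₃ _ _ ih ih' =>
    refine ih.bind ?_
    rintro t f ⟨c, l₁, l₂, o, e, e₁, e₂⟩
    obtain ⟨U, hU, hQ⟩ := ih'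
    refine GrothendieckTopology.Locally.bind (Q := fun t' g => U (g ≫ f))
      ⟨U.pullback f, J.pullback_stable f hU, fun _ _ h => h⟩ ?_
    intro t' g hg
    obtain ⟨c', l₂', l₃, o', e', e₁', e₂'⟩ := hQ _ hg
    refine (hN.exists_square l₂ l₂' ((N.obj c).map g.op o) o' ?_).mono ?_
    · rw [NatTrans.naturality_apply, e₂, e₁', op_comp, Functor.map_comp_apply]
    · rintro t'' g' ⟨d, m, m', o'', em, em₁, em₂⟩
      refine ⟨d, m ≫ l₁, m' ≫ l₃, o'', ?_, ?_, ?_⟩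
      · have := congrArg (fun k => P.map k.op z₂.2.1) em
        simp only [op_comp, Functor.map_comp_apply] at this ⊢
        rw [e, this, e']
      · simp only [Functor.map_comp, NatTrans.comp_app_apply, em₁, NatTrans.naturality_apply, e₁,
          op_comp, comp_apply]
      · simp only [Functor.map_comp, NatTrans.comp_app_apply, em₂, NatTrans.naturality_apply, e₂',
          op_comp, comp_apply]

/-- A form of Diaconescu's theorem: tensoring with a locally flat functor and sheafifying
is left exact. -/
theorem IsLocallyFlat.preservesFiniteLimits (hN : IsLocallyFlat N J) :
    PreservesFiniteLimits (tensor N ⋙ presheafToSheaf J (Type u)) := by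
  have hp {X Y Z : Dᵒᵖ ⥤ Type u} (φ : X ⟶ Z) (ψ : Y ⟶ Z) (b : Dᵒᵖ) :=
    (IsPullback.of_hasPullback φ ψ).map ((evaluation _ _).obj b)
  simp only [Types.isPullback_iff] at hp
  refine preservesFiniteLimits_of_isPullback _ ?_ fun {X Y Z} φ ψ =>
    isPullback_presheafToSheaf (by rw [← Functor.map_comp, pullback.condition, Functor.map_comp])
      ?_ ?_
  · have hu (b : Dᵒᵖ) : Nonempty (Unique ((⊤_ (Dᵒᵖ ⥤ Type u)).obj b)) :=
      ⟨Types.isTerminalEquivUnique _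
        (IsTerminal.isTerminalObj ((evaluation _ _).obj b) _ terminalIsTerminal)⟩
    have hu' (s : Sᵒᵖ) : Nonempty (Unique ((⊤_ (Sᵒᵖ ⥤ Type u)).obj s)) :=
      ⟨Types.isTerminalEquivUnique _
        (IsTerminal.isTerminalObj ((evaluation _ _).obj s) _ terminalIsTerminal)⟩
    let κ : (tensor N).obj (⊤_ _) ⟶ ⊤_ _ := terminal.from _
    have h₁ : Presheaf.IsLocallyInjective J κ := isLocallyInjective_of_locally _ <| by
      rintro s ⟨b₁, z₁, n₁⟩ ⟨b₂, z₂, n₂⟩ -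
      refine (hN.directed n₁ n₂).mono ?_
      rintro t f ⟨c, k, k', o, h₁, h₂⟩
      refine ((tmk_map N _ z₁ n₁).trans ?_).trans (tmk_map N _ z₂ n₂).symm
      have := (hu (.op c)).some
      rw [← h₁, ← h₂, ← tmk_rel, ← tmk_rel, Subsingleton.elim ((⊤_ (Dᵒᵖ ⥤ Type u)).map k.op z₁)]
    have h₂ : Presheaf.IsLocallySurjective J κ := isLocallySurjective_of_locally _ fun s z => by
      refine (hN.nonempty s).mono ?_
      rintro t f ⟨b, ⟨n⟩⟩
      have := (hu' (.op t)).some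
      exact ⟨tmk (hu (.op b)).some.default n, Subsingleton.elim _ _⟩
    have : IsIso ((presheafToSheaf J (Type u)).map κ) := by
      rw [← GrothendieckTopology.W_iff]
      exact J.W_of_isLocallyBijective κ
    exact ⟨(IsTerminal.isTerminalObj (presheafToSheaf J (Type u)) _ terminalIsTerminal).ofIso
      (asIso ((presheafToSheaf J (Type u)).map κ)).symm⟩
  · rintro s ⟨b₁, z₁, n₁⟩ ⟨b₂, z₂, n₂⟩ e₁ e₂
    replace e₁ := hN.exists_of_tmk_eq _ _ _ _ e₁
    obtain ⟨U, hU, h₂⟩ := hN.exists_of_tmk_eq _ _ _ _ e₂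
    refine e₁.bind ?_
    rintro t f ⟨c, l₁, l₂, o, e, h₁, h₁'⟩
    refine GrothendieckTopology.Locally.bind (Q := fun t' g => U (g ≫ f))
      ⟨U.pullback f, J.pullback_stable f hU, fun _ _ h => h⟩ ?_
    intro t' g hg
    obtain ⟨c', k₁, k₂, o', e', h₂, h₂'⟩ := h₂ _ hg
    refine (hN.exists_square l₁ k₁ ((N.obj c).map g.op o) o' ?_).bind ?_
    · rw [NatTrans.naturality_apply, h₁, h₂, op_comp, Functor.map_comp_apply]
    rintro t₁ g₁ ⟨d, m, m', o₁, em, hm, hm'⟩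
    refine (hN.equalize (m ≫ l₂) (m' ≫ k₂) o₁ ?_).mono ?_
    · simp only [Functor.map_comp, NatTrans.comp_app_apply, hm, hm', NatTrans.naturality_apply, h₁',
        h₂', op_comp, comp_apply]
    rintro t₂ g₂ ⟨d', r, o₂, er, hr⟩
    rw [← Category.assoc, ← Category.assoc] at er
    have hz : (pullback φ ψ).map ((r ≫ m) ≫ l₁).op z₁ =
        (pullback φ ψ).map ((r ≫ m) ≫ l₂).op z₂ := by
      refine (hp φ ψ _).2.1 _ _ ⟨?_, ?_⟩
      · have := congrArg (X.map (r ≫ m).op) e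
        simpa only [evaluation_obj_map, NatTrans.naturality_apply, op_comp, Functor.map_comp,
          comp_apply] using this
      · have := congrArg (Y.map (r ≫ m').op) e'
        rw [Category.assoc, em, er, ← Category.assoc]
        simpa only [evaluation_obj_map, NatTrans.naturality_apply, op_comp, Functor.map_comp,
          comp_apply] using this
    have h₃ : (N.map ((r ≫ m) ≫ l₁)).app _ o₂ = (N.obj b₁).map (g₂ ≫ g₁ ≫ g ≫ f).op n₁ := by
      simp only [Functor.map_comp, NatTrans.comp_app_apply, hr, hm, NatTrans.naturality_apply, h₁,
        op_comp, comp_apply]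
    have h₄ : (N.map ((r ≫ m) ≫ l₂)).app _ o₂ = (N.obj b₂).map (g₂ ≫ g₁ ≫ g ≫ f).op n₂ := by
      simp only [Functor.map_comp, NatTrans.comp_app_apply, hr, hm, NatTrans.naturality_apply, h₁',
        op_comp, comp_apply]
    refine ((tmk_map N _ z₁ n₁).trans ?_).trans (tmk_map N _ z₂ n₂).symm
    rw [Category.assoc, Category.assoc, ← h₃, ← h₄, ← tmk_rel, ← tmk_rel, hz]
  · rintro s ⟨b₁, x, n₁⟩ ⟨b₂, y, n₂⟩ e
    refine (hN.exists_of_tmk_eq _ _ _ _ e).mono ?_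
    rintro t k ⟨c, l₁, l₂, o, e, h₁, h₂⟩
    obtain ⟨z, hz₁, hz₂⟩ := (hp φ ψ (.op c)).2.2 (X.map l₁.op x) (Y.map l₂.op y)
      (by simpa [NatTrans.naturality_apply] using e)
    refine ⟨tmk z o, ?_, ?_⟩
    · refine (congrArg (tmk · o) hz₁).trans ((tmk_rel N l₁ x o).trans ?_)
      rw [h₁]; rfl
    · refine (congrArg (tmk · o) hz₂).trans ((tmk_rel N l₂ y o).trans ?_)
      rw [h₂]; rfl

end Tensor

/-! ### The sheaves of realisers -/

section RealisersFunctor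

variable {C : Type u} [SmallCategory C] {S : Type u} [SmallCategory S]
  {J : GrothendieckTopology S}

/-- The functor of sections over `s` of a sheaf-valued functor. -/
abbrev sectionsFunctor (F : C ⥤ Sheaf J (Type u)) (s : Sᵒᵖ) : C ⥤ Type u :=
  F ⋙ sheafToPresheaf J (Type u) ⋙ (evaluation _ _).obj s

/-- Restriction of sections along a morphism, as a natural transformation. -/
abbrev sectionsFunctorMap (F : C ⥤ Sheaf J (Type u)) {s t : Sᵒᵖ} (f : s ⟶ t) :
    sectionsFunctor F s ⟶ sectionsFunctor F t :=
  (F ⋙ sheafToPresheaf J (Type u)).whiskerLeft ((evaluation _ _).map f)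

/-- The natural transformation between functors of sections induced by `α`. -/
abbrev sectionsFunctorHom {F F' : C ⥤ Sheaf J (Type u)} (α : F ⟶ F') (s : Sᵒᵖ) :
    sectionsFunctor F s ⟶ sectionsFunctor F' s :=
  Functor.whiskerRight α (sheafToPresheaf J (Type u) ⋙ (evaluation _ _).obj s)

theorem exists_of_isPullback_sections (F : C ⥤ Sheaf J (Type u)) [PreservesFiniteLimits F]
    {P X Y Z : C} {fst : P ⟶ X} {snd : P ⟶ Y} {f : X ⟶ Z} {g : Y ⟶ Z}
    (h : IsPullback fst snd f g) {s : Sᵒᵖ} (x : (F.obj X).obj.obj s)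
    (y : (F.obj Y).obj.obj s) (e : (F.map f).hom.app s x = (F.map g).hom.app s y) :
    ∃ z, (F.map fst).hom.app s z = x ∧ (F.map snd).hom.app s z = y :=
  Types.exists_of_isPullback (h.map (sectionsFunctor F s)) x y e

variable [CoherentCategory C] (F : C ⥤ Sheaf J (Type u)) [PreservesFiniteLimits F]

/-- The subfunctor of `F X` of sections realising an ultrafilter on `X`. -/
def realisersSubfunctor (A : BooleanSpec C) : Subfunctor (F.obj A.obj).obj where
  obj s := A.type.realisers (sectionsFunctor F s)
  map f _ ha := BooleanType.app_mem_realisers (sectionsFunctorMap F f) ha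

theorem isSheaf_realisersSubfunctor (A : BooleanSpec C) :
    Presheaf.IsSheaf J (realisersSubfunctor F A).toFunctor := by
  rw [isSheaf_iff_isSheaf_of_type, Subfunctor.isSheaf_iff _
    ((isSheaf_iff_isSheaf_of_type J _).1 (F.obj A.obj).property)]
  intro s a ha V hV
  have : Mono (F.map V.arrow) := inferInstance
  exact GrothendieckTopology.Locally.exists_app_eq (F.map V.arrow) ⟨_, ha, fun t f hf => hf V hV⟩

/-- The functor sending `(X, p)` to the sheaf of sections of `F X` realising `p`. It is
the intersection of the `F V`, for `V` in `p`. -/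
noncomputable def realisersFunctor : BooleanSpec C ⥤ Sheaf J (Type u) where
  obj A := ⟨(realisersSubfunctor F A).toFunctor, isSheaf_realisersSubfunctor F A⟩
  map {A B} g := ⟨
    { app s := ↾(fun a => ⟨g.1.eval (sectionsFunctor F s) a,
        Germ.eval_mem_realisers (sectionsFunctor F s) g.2 a⟩)
      naturality s t f := by
        ext a
        exact Subtype.ext
          (Germ.eval_naturality (sectionsFunctor F s) (sectionsFunctorMap F f) g.1 a).symm }⟩
  map_id A := by
    ext s a
    refine Subtype.ext ((Germ.eval_ofHom (sectionsFunctor F s) (𝟙 _) a).trans ?_)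
    simp
  map_comp g h := by
    ext s a
    exact Subtype.ext (Germ.eval_comp (sectionsFunctor F s) g.1 g.2 h.1 a)

/-- The inclusion of the sheaf of realisers of `p` in `F X`. -/
def realisersι (A : BooleanSpec C) : (realisersFunctor F).obj A ⟶ F.obj A.obj :=
  ⟨(realisersSubfunctor F A).ι⟩

/-- Sheaves of realisers are functorial in the sheaf-valued functor. -/
def realisersFunctorMap {F F' : C ⥤ Sheaf J (Type u)} [PreservesFiniteLimits F]
    [PreservesFiniteLimits F'] (α : F ⟶ F') : realisersFunctor F ⟶ realisersFunctor F' where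
  app A := ⟨
    { app s := ↾(fun a => ⟨(α.app A.obj).hom.app s a.1,
        BooleanType.app_mem_realisers (sectionsFunctorHom α s) a.2⟩)
      naturality s t f := by
        ext a
        obtain ⟨a, ha⟩ := a
        have := NatTrans.naturality_apply (α.app A.obj).hom f a
        exact Subtype.ext this }⟩
  naturality A B g := by
    ext s a
    exact Subtype.ext
      (Germ.eval_naturality (sectionsFunctor F s) (sectionsFunctorHom α s) g.1 a)

theorem realisersFunctorMap_ι {F F' : C ⥤ Sheaf J (Type u)} [PreservesFiniteLimits F]
    [PreservesFiniteLimits F'] (α : F ⟶ F') (A : BooleanSpec C) :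
    (realisersFunctorMap α).app A ≫ realisersι F' A = realisersι F A ≫ α.app A.obj := rfl

/-- Every section realises an ultrafilter locally, and nothing realises the bottom subobject. -/
structure LocallyRealises : Prop where
  bot_mem {X : C} (hX : IsBot (⊤ : Subobject X)) {s : S} (a : (F.obj X).obj.obj (.op s)) : ⊥ ∈ J s
  exists_realised {X : C} {s : S} (a : (F.obj X).obj.obj (.op s)) :
    J.Locally (fun t (f : t ⟶ s) => ∃ p : BooleanType X,
      (F.obj X).obj.map f.op a ∈ p.realisers (sectionsFunctor F (.op t)))

theorem exists_of_equalizer_sections {X Y : C} (f g : X ⟶ Y) {s : Sᵒᵖ} (x : (F.obj X).obj.obj s)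
    (e : (F.map f).hom.app s x = (F.map g).hom.app s x) :
    ∃ z, (F.map (equalizer.ι f g)).hom.app s z = x := by
  have h := isLimitForkMapOfIsLimit (sectionsFunctor F s) _ (equalizerIsEqualizer f g)
  let k : PUnit ⟶ (sectionsFunctor F s).obj X := ↾(fun _ => x)
  have hk : k ≫ (sectionsFunctor F s).map f = k ≫ (sectionsFunctor F s).map g := by
    ext
    exact e
  refine ⟨Fork.IsLimit.lift h k hk PUnit.unit, ?_⟩
  exact ConcreteCategory.congr_hom (Fork.IsLimit.lift_ι' h k hk) PUnit.unit

variable {F}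

/-- Realisers of distinct ultrafilters are disjoint. -/
theorem LocallyRealises.bot_mem_of_ne (hF : LocallyRealises F) {X : C} {p q : BooleanType X}
    (hpq : p ≠ q) {s : S} {a : (F.obj X).obj.obj (.op s)}
    (hp : a ∈ p.realisers (sectionsFunctor F (.op s)))
    (hq : a ∈ q.realisers (sectionsFunctor F (.op s))) : ⊥ ∈ J s := by
  obtain ⟨V, hV, W, hW, h⟩ := BooleanType.exists_isComplement_of_ne hpq
  obtain ⟨b, hb⟩ := hp V hV
  obtain ⟨c, hc⟩ := hq W hW
  obtain ⟨z, -, -⟩ := exists_of_isPullback_sections F (IsPullback.of_hasPullback V.arrow W.arrow)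
    b c (hb.trans hc.symm)
  have hf : (V ⊓ W).Factors (pullback.fst V.arrow W.arrow ≫ V.arrow) := by
    rw [Subobject.inf_factors]
    refine ⟨Subobject.factors_comp_arrow _, ?_⟩
    rw [pullback.condition]
    exact Subobject.factors_comp_arrow _
  exact hF.bot_mem (isBot_top_of_isBot h.1) ((F.map (Subobject.factorThru _ _ hf)).hom.app _ z)

theorem LocallyRealises.pushforward_eq_or (hF : LocallyRealises F) {X Y : C} (f : X ⟶ Y)
    {p : BooleanType X} {q : BooleanType Y} {s : S} {a : (F.obj X).obj.obj (.op s)}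
    (hp : a ∈ p.realisers (sectionsFunctor F (.op s)))
    (hq : (F.map f).hom.app _ a ∈ q.realisers (sectionsFunctor F (.op s))) :
    p.pushforward f = q ∨ ⊥ ∈ J s := by
  by_cases h : p.pushforward f = q
  · exact Or.inl h
  · exact Or.inr (hF.bot_mem_of_ne h
      (BooleanType.map_mem_realisers_pushforward (sectionsFunctor F (.op s)) f hp) hq)

/-- A section whose image under `f` realises `q` locally realises ultrafilters over `q`. -/
theorem LocallyRealises.exists_realised_over (hF : LocallyRealises F) {X Y : C} (f : X ⟶ Y)
    {q : BooleanType Y} {s : S} (a : (F.obj X).obj.obj (.op s))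
    (hq : (F.map f).hom.app _ a ∈ q.realisers (sectionsFunctor F (.op s))) :
    J.Locally (fun t (k : t ⟶ s) => ∃ p : BooleanType X, p.pushforward f = q ∧
      (F.obj X).obj.map k.op a ∈ p.realisers (sectionsFunctor F (.op t))) := by
  refine (hF.exists_realised a).bind ?_
  rintro t k ⟨p, hp⟩
  have hq' := BooleanType.app_mem_realisers (sectionsFunctorMap F k.op) hq
  rcases hF.pushforward_eq_or (q := q) f hp
    (by simpa [NatTrans.naturality_apply] using hq') with h | h
  · refine .of_forall fun t' k' => ⟨p, h, ?_⟩
    rw [op_comp, Functor.map_comp_apply]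
    exact BooleanType.app_mem_realisers (sectionsFunctorMap F k'.op) hp
  · exact .of_bot_mem h

/-- Germs with equal values at a realiser of `p` become equal locally, after composition with a
continuous germ through which the realiser lifts. -/
theorem LocallyRealises.equalize_germs (hF : LocallyRealises F) {A : BooleanSpec C} {Y : C}
    (g g' : Germ A.type Y) {s : S} (a : A.type.realisers (sectionsFunctor F (.op s)))
    (e : g.eval (sectionsFunctor F (.op s)) a = g'.eval (sectionsFunctor F (.op s)) a) :
    J.Locally (fun t (f : t ⟶ s) => ∃ (B : BooleanSpec C) (m : B ⟶ A)
      (o : ((realisersFunctor F).obj B).obj.obj (.op t)), m.1.comp m.2 g = m.1.comp m.2 g' ∧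
      ((realisersFunctor F).map m).hom.app _ o =
        ((realisersFunctor F).obj A).obj.map f.op a) := by
  induction g using Germ.ind with | _ k
  induction g' using Germ.ind with | _ k'
  have hP := A.type.inf_mem k.dom_mem k'.dom_mem
  have l₁ : k.dom ⊓ k'.dom ≤ k.dom := inf_le_left
  have l₂ : k.dom ⊓ k'.dom ≤ k'.dom := inf_le_right
  generalize k.dom ⊓ k'.dom = P at hP l₁ l₂
  have h₁ : Germ.mk k = (Germ.toMem A.type P hP).postcomp (Subobject.ofLE _ _ l₁ ≫ k.hom) :=
    Germ.sound ⟨P, hP, l₁, le_rfl, by simp [PartialMap.postcomp]⟩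
  have h₂ : Germ.mk k' = (Germ.toMem A.type P hP).postcomp (Subobject.ofLE _ _ l₂ ≫ k'.hom) :=
    Germ.sound ⟨P, hP, l₂, le_rfl, by simp [PartialMap.postcomp]⟩
  rw [h₁, h₂] at e ⊢
  generalize Subobject.ofLE _ _ l₁ ≫ k.hom = f at e ⊢
  generalize Subobject.ofLE _ _ l₂ ≫ k'.hom = f' at e ⊢
  obtain ⟨b, hb⟩ := a.2 P hP
  have hb' : (Germ.toMem A.type P hP).eval (sectionsFunctor F (.op s)) a = b := by
    apply injective_map_of_mono (sectionsFunctor F (.op s)) P.arrow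
    rw [← Germ.eval_postcomp, Germ.toMem_postcomp_arrow, Germ.eval_ofHom, hb]
    simp
  rw [Germ.eval_postcomp, Germ.eval_postcomp, hb'] at e
  obtain ⟨z, hz⟩ := exists_of_equalizer_sections F f f' b e
  have hz' : (F.map (equalizer.ι f f' ≫ P.arrow)).hom.app _ z = a.1 := by
    rw [← hb, ← hz]
    exact ConcreteCategory.congr_hom
      ((sectionsFunctor F (.op s)).map_comp (equalizer.ι f f') P.arrow) z
  refine (hF.exists_realised_over (equalizer.ι f f' ≫ P.arrow) z (by rw [hz']; exact a.2)).mono ?_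
  rintro t j ⟨p, hp, hzp⟩
  have hc' : (Germ.ofHom p (equalizer.ι f f' ≫ P.arrow)).IsContinuous A.type :=
    (BooleanSpec.homOfEq _ p A.type hp).2
  have hc : (Germ.ofHom p (equalizer.ι f f' ≫ P.arrow)).comp hc' (Germ.toMem A.type P hP) =
      Germ.ofHom p (equalizer.ι f f') := by
    apply Germ.postcomp_injective P.arrow
    dsimp only
    rw [Germ.comp_postcomp, Germ.toMem_postcomp_arrow, Germ.comp_ofHom, Germ.postcomp_id,
      Germ.ofHom_postcomp]
  refine ⟨⟨_, p⟩, BooleanSpec.homOfEq _ p A.type hp, ⟨_, hzp⟩, ?_, Subtype.ext ?_⟩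
  · change (Germ.ofHom p _).comp hc' _ = (Germ.ofHom p _).comp hc' _
    rw [← Germ.comp_postcomp, ← Germ.comp_postcomp, hc, Germ.ofHom_postcomp,
      Germ.ofHom_postcomp, equalizer.condition]
  · refine (Germ.eval_ofHom (sectionsFunctor F (.op t)) _ ⟨_, hzp⟩).trans ?_
    have := NatTrans.naturality_apply (F.map (equalizer.ι f f' ≫ P.arrow)).hom j.op z
    rw [hz'] at this
    exact this

/-- The sheaves of realisers form a locally flat functor: pairs of realisers are refined by
realisers in the product, and parallel germs are equalized on the equalizer of representatives. -/
theorem LocallyRealises.isLocallyFlat (hF : LocallyRealises F) :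
    IsLocallyFlat (realisersFunctor F ⋙ sheafToPresheaf J (Type u)) J where
  nonempty s := by
    have h := IsTerminal.isTerminalObj (sectionsFunctor F (.op s)) _ terminalIsTerminal
    refine (hF.exists_realised ((Types.isTerminalEquivUnique _ h).default :
      (F.obj (⊤_ C)).obj.obj (.op s))).mono ?_
    rintro t f ⟨p, hp⟩
    exact ⟨⟨_, p⟩, ⟨⟨_, hp⟩⟩⟩
  directed {s A B} n n' := by
    have h := Types.isTerminalEquivUnique _
      (IsTerminal.isTerminalObj (sectionsFunctor F (.op s)) _ terminalIsTerminal)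
    obtain ⟨z, hz, hz'⟩ := exists_of_isPullback_sections F (IsPullback.of_hasPullback
      (terminal.from A.obj) (terminal.from B.obj)) n.1 n'.1
      (@Subsingleton.elim _ (@Unique.instSubsingleton _ h) _ _)
    refine (hF.exists_realised_over _ z (by rw [hz]; exact n.2)).bind ?_
    rintro t k ⟨r, hr, hr'⟩
    have e := NatTrans.naturality_apply (F.map (pullback.snd (terminal.from A.obj)
      (terminal.from B.obj))).hom k.op z
    have e' := NatTrans.naturality_apply (F.map (pullback.fst (terminal.from A.obj)
      (terminal.from B.obj))).hom k.op z
    rw [hz'] at e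
    rw [hz] at e'
    rcases hF.pushforward_eq_or (q := B.type) (pullback.snd _ _) hr' (by
      rw [e]
      exact BooleanType.app_mem_realisers (sectionsFunctorMap F k.op) n'.2) with h | h
    · refine .of_forall fun t' k' => ⟨⟨_, r⟩, BooleanSpec.homOfEq _ r A.type hr,
        BooleanSpec.homOfEq _ r B.type h, ((realisersFunctor F).obj _).obj.map k'.op ⟨_, hr'⟩,
        ?_, ?_⟩
      · rw [op_comp, Functor.map_comp_apply]
        refine (NatTrans.naturality_apply ((realisersFunctor F).map _).hom k'.op _).trans
          (congrArg (((realisersFunctor F).obj _).obj.map k'.op) (Subtype.ext ?_))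
        exact (Germ.eval_ofHom (sectionsFunctor F (.op t)) _ ⟨_, hr'⟩).trans e'
      · rw [op_comp, Functor.map_comp_apply]
        refine (NatTrans.naturality_apply ((realisersFunctor F).map _).hom k'.op _).trans
          (congrArg (((realisersFunctor F).obj _).obj.map k'.op) (Subtype.ext ?_))
        exact (Germ.eval_ofHom (sectionsFunctor F (.op t)) _ ⟨_, hr'⟩).trans e
    · exact .of_bot_mem h
  equalize {s A B} k l n e := by
    refine (hF.equalize_germs k.1 l.1 n (congrArg Subtype.val e)).mono ?_
    rintro t f ⟨c, m, o, e, h⟩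
    exact ⟨c, m, o, Subtype.ext e, h⟩

end RealisersFunctor

/-! ### Extending a locally flat functor to sheaves -/

section Extension

variable {D : Type u} [SmallCategory D] {S : Type u} [SmallCategory S]
  {J : GrothendieckTopology S} (N : D ⥤ Sheaf J (Type u))

/-- The extension of `N` to a cocontinuous functor on presheaves. -/
noncomputable abbrev presheafExtension : (Dᵒᵖ ⥤ Type u) ⥤ Sheaf J (Type u) :=
  tensor (N ⋙ sheafToPresheaf J (Type u)) ⋙ presheafToSheaf J (Type u)

/-- The right adjoint of the extension of `N` to presheaves, `E ↦ Hom(N -, E)`. -/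
abbrev presheafRestriction : Sheaf J (Type u) ⥤ Dᵒᵖ ⥤ Type u :=
  sheafToPresheaf J (Type u) ⋙ tensorRightAdjoint (N ⋙ sheafToPresheaf J (Type u))

/-- The extension of `N` to presheaves is left adjoint to `E ↦ Hom(N -, E)`. -/
noncomputable def presheafExtensionAdjunction : presheafExtension N ⊣ presheafRestriction N :=
  (tensorAdjunction (N ⋙ sheafToPresheaf J (Type u))).comp (sheafificationAdjunction J (Type u))

variable {N}

/-- If the extension of `N` to presheaves inverts the inclusion of a sieve, then `Hom(N -, E)` has
the sheaf property for it. The inclusion of a sieve goes to a monomorphism by flatness, and to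
an epimorphism as soon as elements of `N` come locally from the sieve. -/
theorem isSheafFor_presheafRestriction (hN : IsLocallyFlat (N ⋙ sheafToPresheaf J (Type u)) J)
    {b : D} (R : Sieve b)
    (hR : ∀ ⦃s : S⦄ (n : (N.obj b).obj.obj (.op s)), J.Locally (fun t (f : t ⟶ s) =>
      ∃ (c : D) (r : c ⟶ b) (m : (N.obj c).obj.obj (.op t)), R r ∧
        (N.map r).hom.app _ m = (N.obj b).obj.map f.op n))
    (E : Sheaf J (Type u)) : Presieve.IsSheafFor ((presheafRestriction N).obj E) R.arrows := by
  have := hN.preservesFiniteLimits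
  have h₁ : Mono ((presheafExtension N).map R.functorInclusion) := inferInstance
  have h₂ : Presheaf.IsLocallySurjective J
      ((tensor (N ⋙ sheafToPresheaf J (Type u))).map R.functorInclusion) := by
    refine isLocallySurjective_of_locally _ ?_
    rintro s ⟨c, x, n⟩
    refine (hR ((N.map x).hom.app _ n)).mono ?_
    rintro t f ⟨c', r, m, hr, hm⟩
    refine ⟨tmk (N := N ⋙ sheafToPresheaf J (Type u)) (P := R.functor) (b := c') ⟨r, hr⟩ m, ?_⟩
    have hx {c : D} (x : c ⟶ b) : (yoneda.obj b).map x.op (𝟙 b) = x := Category.comp_id x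
    have e₁ := tmk_rel (N ⋙ sheafToPresheaf J (Type u)) (P := yoneda.obj b) r (𝟙 b) m
    have e₂ := tmk_rel (N ⋙ sheafToPresheaf J (Type u)) (P := yoneda.obj b) x (𝟙 b)
      ((N.obj c).obj.map f.op n)
    rw [hx] at e₁ e₂
    refine e₁.trans ((congrArg _ ?_).trans e₂.symm)
    exact hm.trans (NatTrans.naturality_apply (N.map x).hom f.op n).symm
  have h₃ : Epi ((presheafExtension N).map R.functorInclusion) := by
    have := (Presheaf.isLocallySurjective_presheafToSheaf_map_iff J _).2 h₂
    exact Sheaf.epi_of_isLocallySurjective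
      ((presheafToSheaf J (Type u)).map ((tensor _).map R.functorInclusion))
  have h₄ : IsIso ((presheafExtension N).map R.functorInclusion) := isIso_of_mono_of_epi _
  rw [Presieve.isSheafFor_iff_yonedaSheafCondition]
  intro k
  -- transpose along the adjunction, where the inclusion of the sieve is invertible
  let adj := presheafExtensionAdjunction N
  refine ⟨adj.homEquiv _ _ (inv ((presheafExtension N).map R.functorInclusion) ≫
    (adj.homEquiv _ _).symm k), ?_, ?_⟩
  · dsimp only
    rw [← Adjunction.homEquiv_naturality_left, IsIso.hom_inv_id_assoc, Equiv.apply_symm_apply]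
  · intro l hl
    rw [← hl, Adjunction.homEquiv_naturality_left_symm, IsIso.inv_hom_id_assoc,
      Equiv.apply_symm_apply]

variable {K : GrothendieckTopology D}
  (hK : ∀ E, Presheaf.IsSheaf K ((presheafRestriction N).obj E))

/-- The extension of `N` to sheaves. -/
noncomputable abbrev sheafExtension (N : D ⥤ Sheaf J (Type u)) (K : GrothendieckTopology D) :
    Sheaf K (Type u) ⥤ Sheaf J (Type u) :=
  sheafToPresheaf K (Type u) ⋙ presheafExtension N

/-- The functor `E ↦ Hom(N -, E)`, with values in sheaves. -/
abbrev sheafRestriction : Sheaf J (Type u) ⥤ Sheaf K (Type u) :=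
  ObjectProperty.lift _ (presheafRestriction N) hK

/-- The extension of `N` to sheaves is left adjoint to `E ↦ Hom(N -, E)` as soon as the latter
takes values in sheaves. -/
noncomputable def sheafExtensionAdjunction : sheafExtension N K ⊣ sheafRestriction hK :=
  (presheafExtensionAdjunction N).restrictFullyFaithful (fullyFaithfulSheafToPresheaf K (Type u))
    (Functor.FullyFaithful.id _) (Iso.refl _) (Iso.refl _)

/-- The extension to sheaves of the sheafification of a presheaf is its extension. -/
noncomputable def presheafToSheafCompSheafExtension :
    presheafToSheaf K (Type u) ⋙ sheafExtension N K ≅ presheafExtension N :=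
  ((sheafificationAdjunction K (Type u)).comp (sheafExtensionAdjunction hK)).leftAdjointUniq
    (presheafExtensionAdjunction N)

end Extension

/-! ### The classifying property for coherent functors with enough realisers -/

section Classify

variable {C : Type u} [SmallCategory C] [CoherentCategory C] {S : Type u} [SmallCategory S]
  {J : GrothendieckTopology S} {F : C ⥤ Sheaf J (Type u)} [PreservesFiniteLimits F]

theorem BooleanSpec.family_homOfEq {X Y : C} (f : X ⟶ Y) (p : BooleanType X) {q : BooleanType Y}
    (h : p.pushforward f = q) : BooleanSpec.family f q (BooleanSpec.homOfEq f p q h) :=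
  Presieve.ofArrows.mk
    (f := fun p : {p : BooleanType X // p.pushforward f = q} => BooleanSpec.homOfEq f p.1 q p.2)
    ⟨p, h⟩

/-- A realiser of `q` lifts locally along an effective epimorphism `f`, and the lift locally
realises an ultrafilter whose image under `f` is `q`; so covers in `E` go to covers. -/
theorem LocallyRealises.isSheaf_presheafRestriction (hF : LocallyRealises F)
    (hepi : ∀ {X Y : C} (f : X ⟶ Y), EffectiveEpi f → Epi (F.map f)) (E : Sheaf J (Type u)) :
    Presheaf.IsSheaf (BooleanSpec.topologyE C)
      ((presheafRestriction (realisersFunctor F)).obj E) := by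
  rw [isSheaf_iff_isSheaf_of_type]
  refine (Precoverage.isSheaf_toGrothendieck_iff _).2 ?_
  rintro B A g R ⟨X, f, hf, rfl⟩
  refine isSheafFor_presheafRestriction hF.isLocallyFlat _ ?_ E
  intro s n
  have := hepi f hf
  have : Sheaf.IsLocallySurjective (F.map f) := (Sheaf.isLocallySurjective_iff_epi _).2 this
  have h₁ : J.Locally (fun t (k : t ⟶ s) => ∃ (p : BooleanType X) (h : p.pushforward f = B.type)
      (m : ((realisersFunctor F).obj ⟨X, p⟩).obj.obj (.op t)),
      ((realisersFunctor F).map (BooleanSpec.homOfEq f p B.type h)).hom.app _ m =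
        ((realisersFunctor F).map g).hom.app _ (((realisersFunctor F).obj A).obj.map k.op n)) := by
    refine (locally_exists_app_eq (F.map f).hom
      (((realisersFunctor F).map g).hom.app _ n).1).bind ?_
    rintro t k ⟨a, ha⟩
    refine (hF.exists_realised_over f a (q := B.type) ?_).mono ?_
    · rw [ha]
      exact BooleanType.app_mem_realisers (sectionsFunctorMap F k.op)
        (((realisersFunctor F).map g).hom.app _ n).2
    · rintro t' k' ⟨p, hp, hp'⟩
      refine ⟨p, hp, ⟨_, hp'⟩, ?_⟩
      rw [NatTrans.naturality_apply]
      refine Subtype.ext ((Germ.eval_ofHom (sectionsFunctor F (.op t')) f ⟨_, hp'⟩).trans ?_)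
      have := NatTrans.naturality_apply (F.map f).hom k'.op a
      refine this.trans ?_
      rw [ha, ← Functor.map_comp_apply]
      rfl
  refine h₁.bind ?_
  rintro t k ⟨p, h, m, hm⟩
  refine (hF.isLocallyFlat.exists_square (BooleanSpec.homOfEq f p B.type h) g m
    (((realisersFunctor F).obj A).obj.map k.op n) hm).mono ?_
  rintro t' k' ⟨c, l₁, l₂, o, e, -, h₂⟩
  refine ⟨c, l₂, o, ⟨_, l₁, _, BooleanSpec.family_homOfEq f p h, e⟩, h₂.trans ?_⟩
  rw [op_comp, Functor.map_comp_apply]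
  rfl

/-- Evaluation of germs at realisers. -/
noncomputable def evalGerms (F : C ⥤ Sheaf J (Type u)) [PreservesFiniteLimits F] :
    germPresheaf C ⋙ tensor (realisersFunctor F ⋙ sheafToPresheaf J (Type u)) ⟶
      F ⋙ sheafToPresheaf J (Type u) where
  app Y :=
    { app s := ↾(Quot.lift (fun z => Germ.eval (sectionsFunctor F s) (p := z.1.type)
        z.2.1 z.2.2) (by
        rintro _ _ ⟨k, x, n⟩
        exact Germ.eval_comp (sectionsFunctor F s) k.1 k.2 x n))
      naturality s t f := by
        ext ⟨A, g, n⟩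
        exact (Germ.eval_naturality (sectionsFunctor F s) (sectionsFunctorMap F f) _ n).symm }
  naturality Y Z k := by
    ext s ⟨A, g, n⟩
    exact Germ.eval_postcomp (sectionsFunctor F s) (p := A.type) g k n

/-- Every section is locally the value of the germ of an identity at a realiser. Two germs with
equal values become equal after passing to a common refinement and an equalizer. -/
theorem LocallyRealises.isIso_evalGerms (hF : LocallyRealises F) :
    IsIso (Functor.whiskerRight (evalGerms F) (presheafToSheaf J (Type u))) := by
  have (Y : C) :
      IsIso ((Functor.whiskerRight (evalGerms F) (presheafToSheaf J (Type u))).app Y) := by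
    let φ := (evalGerms F).app Y
    have h₁ : Presheaf.IsLocallyInjective J φ := isLocallyInjective_of_locally _ <| by
      rintro s ⟨A, (g : Germ A.type Y), n⟩ ⟨A', (g' : Germ A'.type Y), n'⟩ e
      replace e : Germ.eval (sectionsFunctor F (.op s)) (p := A.type) g n =
        Germ.eval (sectionsFunctor F (.op s)) (p := A'.type) g' n' := e
      refine (hF.isLocallyFlat.directed n n').bind ?_
      rintro t f ⟨B, k, k', o, h, h'⟩
      refine (hF.equalize_germs (A := B) (k.1.comp k.2 g) (k'.1.comp k'.2 g') o ?_).mono ?_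
      · have e₁ := Germ.eval_naturality (sectionsFunctor F (.op s)) (sectionsFunctorMap F f.op)
          (p := A.type) g n
        have e₂ := Germ.eval_naturality (sectionsFunctor F (.op s)) (sectionsFunctorMap F f.op)
          (p := A'.type) g' n'
        rw [e] at e₁
        have e₃ := e₁.symm.trans e₂
        refine (Germ.eval_comp (sectionsFunctor F (.op t)) k.1 k.2 g o).trans
          (Eq.trans ?_ (Germ.eval_comp (sectionsFunctor F (.op t)) k'.1 k'.2 g' o).symm)
        have h₁ : (⟨k.1.eval (sectionsFunctor F (.op t)) o,
            Germ.eval_mem_realisers (sectionsFunctor F (.op t)) k.2 o⟩ :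
          A.type.realisers (sectionsFunctor F (.op t))) = _ := h
        have h₂ : (⟨k'.1.eval (sectionsFunctor F (.op t)) o,
            Germ.eval_mem_realisers (sectionsFunctor F (.op t)) k'.2 o⟩ :
          A'.type.realisers (sectionsFunctor F (.op t))) = _ := h'
        rw [h₁, h₂]
        exact e₃
      · rintro t' f' ⟨B', m, o', em, ho⟩
        have cong {z z' : Germ B'.type Y} (h : z = z') :
            tmk (N := realisersFunctor F ⋙ sheafToPresheaf J (Type u))
              (P := (germPresheaf C).obj Y) (b := B') z o' = tmk (b := B') z' o' := by rw [h]
        have key {A : BooleanSpec C} (g : Germ A.type Y)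
            (n : ((realisersFunctor F).obj A).obj.obj (.op s)) (k : B ⟶ A)
            (h : ((realisersFunctor F).map k).hom.app _ o =
              ((realisersFunctor F).obj A).obj.map f.op n) :
            tmk (N := realisersFunctor F ⋙ sheafToPresheaf J (Type u))
              (P := (germPresheaf C).obj Y) (b := A) g
              (((realisersFunctor F).obj A).obj.map (f' ≫ f).op n) =
            tmk (b := B') (m.1.comp m.2 (k.1.comp k.2 g)) o' := by
          have e₁ := tmk_rel (realisersFunctor F ⋙ sheafToPresheaf J (Type u))
            (P := (germPresheaf C).obj Y) (m ≫ k) g o'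
          have e₂ : ((realisersFunctor F ⋙ sheafToPresheaf J (Type u)).map (m ≫ k)).app _ o' =
              ((realisersFunctor F).obj A).obj.map (f' ≫ f).op n := by
            rw [Functor.map_comp, NatTrans.comp_app_apply]
            refine (congrArg _ ho).trans ((NatTrans.naturality_apply
              ((realisersFunctor F).map k).hom f'.op o).trans ?_)
            rw [h, ← Functor.map_comp_apply]
            rfl
          rw [e₂] at e₁
          rw [← e₁]
          exact cong (Germ.assoc m.1 m.2 k.1 k.2 g)
        refine ((tmk_map _ _ _ _).trans ?_).trans (tmk_map _ _ _ _).symm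
        exact (key g n k h).trans ((cong em).trans (key g' n' k' h').symm)
    have h₂ : Presheaf.IsLocallySurjective J φ := isLocallySurjective_of_locally _ fun s a => by
      refine (hF.exists_realised a).mono ?_
      rintro t f ⟨p, hp⟩
      refine ⟨tmk (N := realisersFunctor F ⋙ sheafToPresheaf J (Type u))
        (P := (germPresheaf C).obj Y) (b := ⟨Y, p⟩) (Germ.ofHom p (𝟙 Y)) ⟨_, hp⟩, ?_⟩
      refine (Germ.eval_ofHom (sectionsFunctor F (.op t)) (𝟙 Y) ⟨_, hp⟩).trans ?_
      simp
    rw [Functor.whiskerRight_app, ← GrothendieckTopology.W_iff]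
    exact J.W_of_isLocallyBijective φ
  exact NatIso.isIso_of_isIso_app _

end Classify

section Classify

variable {C : Type u} [SmallCategory C] [CoherentCategory C] {S : Type u} [SmallCategory S]
  {J : GrothendieckTopology S} {F : C ⥤ Sheaf J (Type u)} [PreservesFiniteLimits F]

/-- The extension of the sheaves of realisers of `F` to a functor on the topos of sheaves on the
category of ultrafilters. -/
noncomputable abbrev realisersExtension (F : C ⥤ Sheaf J (Type u)) [PreservesFiniteLimits F] :
    TypeTopos C ⥤ Sheaf J (Type u) :=
  sheafExtension (realisersFunctor F) (BooleanSpec.topologyE C)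

theorem LocallyRealises.lexCocontinuous_realisersExtension (hF : LocallyRealises F)
    (hepi : ∀ {X Y : C} (f : X ⟶ Y), EffectiveEpi f → Epi (F.map f)) :
    lexCocontinuous _ _ (realisersExtension F) := by
  have := hF.isLocallyFlat.preservesFiniteLimits
  exact ⟨comp_preservesFiniteLimits (sheafToPresheaf _ _) (presheafExtension (realisersFunctor F)),
    (sheafExtensionAdjunction (hF.isSheaf_presheafRestriction hepi)).leftAdjoint_preservesColimits⟩

/-- A functor that realises ultrafilters locally is recovered from its sheaves of realisers. -/
theorem LocallyRealises.nonempty_iso_realisersExtension (hF : LocallyRealises F)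
    (hepi : ∀ {X Y : C} (f : X ⟶ Y), EffectiveEpi f → Epi (F.map f)) :
    Nonempty (typeModel C ⋙ realisersExtension F ≅ F) := by
  have := hF.isIso_evalGerms
  exact ⟨Functor.associator _ _ _ ≪≫ Functor.isoWhiskerLeft (germPresheaf C)
      (presheafToSheafCompSheafExtension (hF.isSheaf_presheafRestriction hepi)) ≪≫
    (Functor.associator _ _ _).symm ≪≫
    asIso (Functor.whiskerRight (evalGerms F) (presheafToSheaf J (Type u))) ≪≫
    Functor.associator _ _ _ ≪≫
    Functor.isoWhiskerLeft F (asIso (sheafificationAdjunction J (Type u)).counit) ≪≫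
    F.rightUnitor⟩

end Classify

/-! ### Coherence of the universal functor -/

section CoherenceCriterion

variable {C : Type u₁} [Category.{v₁} C] [CoherentCategory C] {E : Type u₂} [Category.{v₂} E]
  [HasPullbacks E] [IsRegularEpiCategory E] [Balanced E]

/-- In the presence of finite limits, a functor to a balanced category in which all epimorphisms
are regular is coherent as soon as it turns the three kinds of covers of a coherent category into
jointly epic families. -/
theorem isCoherentFunctor_of_epi (F : C ⥤ E) [PreservesFiniteLimits F]
    (hepi : ∀ {X Y : C} (f : X ⟶ Y), EffectiveEpi f → Epi (F.map f))
    (hbot : ∀ {X : C}, IsBot (⊤ : Subobject X) → Nonempty (IsInitial (F.obj X)))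
    (hunion : ∀ {X : C} {S T : Subobject X}, IsLUB {S, T} ⊤ → ∀ {Z : E} (a b : F.obj X ⟶ Z),
      F.map S.arrow ≫ a = F.map S.arrow ≫ b → F.map T.arrow ≫ a = F.map T.arrow ≫ b → a = b) :
    IsCoherentFunctor F where
  effectiveEpi_map f hf := by
    have := hepi f hf
    have := IsRegularEpiCategory.regularEpiOfEpi (F.map f)
    exact (isRegularEpi_iff_effectiveEpi _).1 this
  isBot_map B hB Q := by
    obtain ⟨hI⟩ := hbot (X := (B : C)) (isBot_top_of_isBot hB)
    exact Subobject.mk_le_of_comm (hI.to _) (hI.hom_ext _ _)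
  isLUB_map {X} S T U hU := by
    have mono {V W : Subobject X} (h : V ≤ W) : Subobject.mapLex F V ≤ Subobject.mapLex F W :=
      Subobject.mk_le_mk_of_comm (F.map (Subobject.ofLE V W h)) (by
        rw [← F.map_comp, Subobject.ofLE_arrow])
    refine ⟨?_, fun Q hQ => ?_⟩
    · rintro _ (rfl | rfl)
      · exact mono (hU.1 (Or.inl rfl))
      · exact mono (hU.1 (Or.inr rfl))
    · have h := CoherentCategory.isLUB_pullback U.arrow hU
      rw [pullback_arrow_self] at h
      let P := (Subobject.pullback (F.map U.arrow)).obj Q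
      have fac {V : Subobject X} (hV : Subobject.mapLex F V ≤ Q) :
          P.Factors (F.map ((Subobject.pullback U.arrow).obj V).arrow) := by
        refine Limits.pullback_factors _ _ _ ?_
        rw [← F.map_comp, ← (Subobject.isPullback U.arrow V).w, F.map_comp]
        exact Subobject.factors_of_le _ hV
          ((Subobject.mk_factors_iff _ _).2 ⟨F.map (Subobject.pullbackπ U.arrow V), rfl⟩)
      -- the pullback of `Q` to `F U` is an epic subobject, hence everything
      have hP : Epi P.arrow := ⟨fun a b e => by
        refine hunion h a b ?_ ?_
        · rw [← Subobject.factorThru_arrow P _ (fac (hQ (Or.inl rfl))), Category.assoc, e,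
            Category.assoc]
        · rw [← Subobject.factorThru_arrow P _ (fac (hQ (Or.inr rfl))), Category.assoc, e,
            Category.assoc]⟩
      have hP' : IsIso P.arrow := isIso_of_mono_of_epi _
      refine Subobject.mk_le_of_comm (inv P.arrow ≫ Subobject.pullbackπ (F.map U.arrow) Q) ?_
      rw [Category.assoc, (Subobject.isPullback (F.map U.arrow) Q).w, IsIso.inv_hom_id_assoc]

end CoherenceCriterion

section UnionCovers

variable {C : Type u₁} [Category.{v₁} C] [CoherentCategory C]

theorem isComplement_of_isColimit [BinaryCoproductsDisjoint C] {A B X : C} {i : A ⟶ X} {j : B ⟶ X}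
    [Mono i] [Mono j] (h : IsColimit (BinaryCofan.mk i j)) :
    IsComplement (Subobject.mk i) (Subobject.mk j) := by
  constructor
  · let hI : IsInitial (pullback i j) := IsInitial.ofBinaryCoproductDisjointOfIsColimit h
    have hf : (Subobject.mk i).Factors (Subobject.mk i ⊓ Subobject.mk j).arrow :=
      Subobject.factors_of_le _ inf_le_left (Subobject.factors_self _)
    have hg : (Subobject.mk j).Factors (Subobject.mk i ⊓ Subobject.mk j).arrow :=
      Subobject.factors_of_le _ inf_le_right (Subobject.factors_self _)
    obtain ⟨a : _ ⟶ A, ha : a ≫ i = _⟩ := (Subobject.mk_factors_iff _ _).1 hf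
    obtain ⟨b : _ ⟶ B, hb : b ≫ j = _⟩ := (Subobject.mk_factors_iff _ _).1 hg
    intro Q
    refine Subobject.le_of_comm (pullback.lift a b (ha.trans hb.symm) ≫ hI.to _) ?_
    rw [Category.assoc, hI.hom_ext (hI.to _ ≫ Q.arrow) (pullback.fst i j ≫ i),
      pullback.lift_fst_assoc]
    exact ha
  · refine ⟨fun _ _ => le_top, fun Q hQ => ?_⟩
    have hi : Subobject.mk i ≤ Q := hQ (Or.inl rfl)
    have hj : Subobject.mk j ≤ Q := hQ (Or.inr rfl)
    have hi' : Q.Factors i :=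
      Subobject.factors_of_le _ hi ((Subobject.mk_factors_iff _ _).2 ⟨𝟙 _, Category.id_comp i⟩)
    have hj' : Q.Factors j :=
      Subobject.factors_of_le _ hj ((Subobject.mk_factors_iff _ _).2 ⟨𝟙 _, Category.id_comp j⟩)
    obtain ⟨(s : X ⟶ (Q : C)), (hs : i ≫ s = _), (hs' : j ≫ s = _)⟩ :=
      BinaryCofan.IsColimit.desc' h (Q.factorThru i hi') (Q.factorThru j hj')
    have e : s ≫ Q.arrow = 𝟙 X := by
      apply BinaryCofan.IsColimit.hom_ext h
      · change i ≫ s ≫ Q.arrow = i ≫ 𝟙 X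
        rw [← Category.assoc, hs, Subobject.factorThru_arrow, Category.comp_id]
      · change j ≫ s ≫ Q.arrow = j ≫ 𝟙 X
        rw [← Category.assoc, hs', Subobject.factorThru_arrow, Category.comp_id]
    exact Subobject.le_of_comm ((⊤ : Subobject X).arrow ≫ s) (by
      rw [Category.assoc, e, Category.comp_id])

/-- A union of two subobjects is an effective epimorphic image of their coproduct. -/
theorem effectiveEpi_coprod_desc_of_isLUB [HasBinaryCoproducts C] {X : C} {S T : Subobject X}
    (h : IsLUB {S, T} ⊤) : EffectiveEpi (coprod.desc S.arrow T.arrow) := by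
  have : ExtremalEpi (coprod.desc S.arrow T.arrow) := by
    refine ExtremalEpi.mk_of_hasEqualizers _ fun Z p i e hi => ?_
    rw [Subobject.isIso_iff_mk_eq_top, ← top_le_iff]
    refine h.2 ?_
    rintro _ (rfl | rfl)
    · exact Subobject.le_mk_of_comm (coprod.inl ≫ p) (by rw [Category.assoc, e, coprod.inl_desc])
    · exact Subobject.le_mk_of_comm (coprod.inr ≫ p) (by rw [Category.assoc, e, coprod.inr_desc])
  exact (isRegularEpi_iff_effectiveEpi _).1 inferInstance

end UnionCovers

section UniversalModel

variable {C : Type u} [SmallCategory C] [CoherentCategory C]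

instance : PreservesFiniteLimits (germPresheaf C) := by
  refine preservesFiniteLimits_of_isPullback _ ⟨?_⟩ ?_
  · exact IsTerminal.ofUniqueHom
      (fun Q =>
        { app A := ↾(fun _ => Germ.ofHom A.unop.type (terminal.from A.unop.obj))
          naturality A B f := by ext a; exact Germ.eq_of_isTerminal terminalIsTerminal _ _ })
      (fun Q m => by ext A a; exact Germ.eq_of_isTerminal terminalIsTerminal _ _)
  · intro X Y Z f g
    refine IsPullback.of_forall_isPullback_app fun A => ?_
    have h := IsPullback.of_hasPullback f g
    rw [Types.isPullback_iff]
    refine ⟨?_, ?_, ?_⟩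
    · rw [← NatTrans.comp_app, ← Functor.map_comp, pullback.condition, Functor.map_comp]
      rfl
    · rintro a b ⟨e, e'⟩
      exact Germ.ext_of_jointly_mono _ _ (fun _ _ _ h h' => pullback.hom_ext h h') e e'
    · intro a b e
      exact Germ.exists_lift_of_isPullback h a b e

instance : PreservesFiniteLimits (typeModel C) := comp_preservesFiniteLimits _ _

/-- There are no germs with values in the bottom subobject. -/
theorem nonempty_isInitial_typeModel {X : C} (hX : IsBot (⊤ : Subobject X)) :
    Nonempty (IsInitial ((typeModel C).obj X)) := by
  have (A : (BooleanSpec C)ᵒᵖ) : IsEmpty (((germPresheaf C).obj X).obj A) :=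
    ⟨fun g => by
      obtain ⟨q, -⟩ := Germ.exists_isContinuous g
      exact q.not_isBot_top hX⟩
  have hI : IsInitial ((germPresheaf C).obj X) := IsInitial.ofUniqueHom
    (fun Q => { app A := ↾(fun a => ((this A).false a).elim)
                naturality A B f := by ext a; exact ((this A).false a).elim })
    (fun Q m => by ext A a; exact ((this A).false a).elim)
  exact ⟨hI.isInitialObj (presheafToSheaf _ _)⟩

/-- A germ lifts through one of two complementary subobjects, which therefore cover. -/
theorem typeModel_ext_of_isComplement {X : C} {V W : Subobject X} (h : IsComplement V W)
    {Z : TypeTopos C} {a b : (typeModel C).obj X ⟶ Z}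
    (hV : (typeModel C).map V.arrow ≫ a = (typeModel C).map V.arrow ≫ b)
    (hW : (typeModel C).map W.arrow ≫ a = (typeModel C).map W.arrow ≫ b) : a = b := by
  let adj := sheafificationAdjunction (BooleanSpec.topologyE C) (Type u)
  apply (adj.homEquiv _ _).injective
  ext ⟨A⟩ g
  obtain ⟨q, hq⟩ := Germ.exists_isContinuous g
  have key {V : Subobject X} (hVq : V ∈ q.carrier)
      (e : (typeModel C).map V.arrow ≫ a = (typeModel C).map V.arrow ≫ b) :
      (adj.homEquiv _ _ a).app _ g = (adj.homEquiv _ _ b).app _ g := by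
    obtain ⟨g', rfl⟩ := Germ.exists_lift_of_isContinuous hq hVq
    have e' := congrArg (adj.homEquiv _ _) e
    replace e' := (adj.homEquiv_naturality_left _ _).symm.trans
      (e'.trans (adj.homEquiv_naturality_left _ _))
    exact ConcreteCategory.congr_hom (NatTrans.congr_app e' (.op A)) g'
  rcases q.mem_or_mem h with h | h
  · exact key h hV
  · exact key h hW

/-- Germs of maps lift locally along effective epimorphisms. -/
theorem epi_typeModel_map {X Y : C} (f : X ⟶ Y) (hf : EffectiveEpi f) :
    Epi ((typeModel C).map f) := by
  have h : Presheaf.IsLocallySurjective (BooleanSpec.topologyE C) ((germPresheaf C).map f) := by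
    refine isLocallySurjective_of_locally _ fun A g => ?_
    revert g
    refine Germ.ind fun k => ?_
    -- the germ is a map on its domain, where the pullback of `f` gives a cover
    let r := A.type.restrict k.dom k.dom_mem
    let θ : A ⟶ ⟨_, r⟩ := ⟨Germ.toMem A.type k.dom k.dom_mem, Germ.isContinuous_toMem _ _⟩
    have : IsRegularEpi f := (isRegularEpi_iff_effectiveEpi _).2 hf
    have hπ : EffectiveEpi (pullback.snd f k.hom) :=
      (isRegularEpi_iff_effectiveEpi _).1 inferInstance
    refine ⟨(Sieve.generate (BooleanSpec.family (pullback.snd f k.hom) r)).pullback θ,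
      GrothendieckTopology.pullback_stable _ θ
        (Precoverage.generate_mem_toGrothendieck ⟨_, _, hπ, rfl⟩), ?_⟩
    rintro B m ⟨B', l, _, ⟨p⟩, e⟩
    refine ⟨l.1.comp l.2 (Germ.ofHom p.1 (pullback.fst f k.hom)), ?_⟩
    have e' : l.1.comp l.2 (Germ.ofHom p.1 (pullback.snd f k.hom)) =
      m.1.comp m.2 (Germ.toMem A.type k.dom k.dom_mem) := congrArg Subtype.val e
    change Germ.postcomp _ f = m.1.comp m.2 (Germ.mk k)
    rw [Germ.comp_postcomp, Germ.ofHom_postcomp, pullback.condition, ← Germ.ofHom_postcomp,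
      ← Germ.comp_postcomp, e', Germ.comp_postcomp, Germ.toMem_postcomp]
  have := (Presheaf.isLocallySurjective_presheafToSheaf_map_iff _ _).2 h
  exact Sheaf.epi_of_isLocallySurjective ((presheafToSheaf _ _).map ((germPresheaf C).map f))

theorem typeModel_ext_of_isLUB (hC : HasFiniteDisjointCoproducts C ∨ IsBooleanCategory C) {X : C}
    {S T : Subobject X} (h : IsLUB {S, T} ⊤) {Z : TypeTopos C} (a b : (typeModel C).obj X ⟶ Z)
    (hS : (typeModel C).map S.arrow ≫ a = (typeModel C).map S.arrow ≫ b)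
    (hT : (typeModel C).map T.arrow ≫ a = (typeModel C).map T.arrow ≫ b) : a = b := by
  rcases hC with ⟨_, _⟩ | hC
  · -- in the coproduct of `S` and `T`, which covers `X`, the two summands are complementary
    have := epi_typeModel_map _ (effectiveEpi_coprod_desc_of_isLUB h)
    rw [← cancel_epi ((typeModel C).map (coprod.desc S.arrow T.arrow))]
    refine typeModel_ext_of_isComplement
      (isComplement_of_isColimit (coprodIsCoprod (S : C) (T : C))) ?_ ?_
    · rw [← Subobject.underlyingIso_hom_comp_eq_mk, Functor.map_comp, Category.assoc,
        Category.assoc,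
        ← Functor.map_comp_assoc _ coprod.inl, ← Functor.map_comp_assoc _ coprod.inl,
        coprod.inl_desc,
        hS]
    · rw [← Subobject.underlyingIso_hom_comp_eq_mk, Functor.map_comp, Category.assoc,
        Category.assoc,
        ← Functor.map_comp_assoc _ coprod.inr, ← Functor.map_comp_assoc _ coprod.inr,
        coprod.inr_desc,
        hT]
  · -- the complement of `S` lies in `T`
    obtain ⟨W, hW⟩ := hC X S
    have hWT : W ≤ T := le_of_isLUB_of_isBot_inf h hW.symm.1
    refine typeModel_ext_of_isComplement hW hS ?_
    rw [← Subobject.ofLE_arrow hWT, Functor.map_comp, Category.assoc, hT, Category.assoc]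

theorem isCoherentFunctor_typeModel
    (hC : HasFiniteDisjointCoproducts C ∨ IsBooleanCategory C) : IsCoherentFunctor (typeModel C) :=
  isCoherentFunctor_of_epi _ epi_typeModel_map nonempty_isInitial_typeModel
    (typeModel_ext_of_isLUB hC)

theorem isCoherentFunctor_typeModel_comp
    (hC : HasFiniteDisjointCoproducts C ∨ IsBooleanCategory C) {E : Type w} [Category.{u} E]
    [HasPullbacks E] [IsRegularEpiCategory E] [Balanced E] {M : TypeTopos C ⥤ E}
    (hM : lexCocontinuous _ _ M) : IsCoherentFunctor (typeModel C ⋙ M) := by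
  have := hM.1
  have := hM.2
  have : PreservesFiniteColimits M := PreservesColimitsOfSize.preservesFiniteColimits M
  have : PreservesFiniteLimits (typeModel C ⋙ M) := comp_preservesFiniteLimits _ _
  refine isCoherentFunctor_of_epi _ (fun f hf => ?_) (fun hX => ?_)
    (fun {X S T} h Z a b hS hT => ?_)
  · have := epi_typeModel_map f hf
    exact inferInstanceAs (Epi (M.map _))
  · exact ⟨(nonempty_isInitial_typeModel hX).some.isInitialObj M⟩
  · have : HasBinaryCoproducts (TypeTopos C) :=
      hasColimitsOfShape_of_reflective (sheafToPresheaf (BooleanSpec.topologyE C) (Type u))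
    let d := coprod.desc ((typeModel C).map S.arrow) ((typeModel C).map T.arrow)
    have hd : Epi d := ⟨fun a b e => typeModel_ext_of_isLUB hC h a b
      (by
        have h := coprod.inl ≫= e
        rwa [← Category.assoc, ← Category.assoc, coprod.inl_desc] at h) (by
        have h := coprod.inr ≫= e
        rwa [← Category.assoc, ← Category.assoc, coprod.inr_desc] at h)⟩
    have hd' : Epi (M.map d) := inferInstance
    rw [← cancel_epi (M.map d)]
    have hc := mapIsColimitOfPreservesOfIsColimit M _ _
      (coprodIsCoprod ((typeModel C).obj (S : C)) ((typeModel C).obj (T : C)))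
    apply BinaryCofan.IsColimit.hom_ext hc
    · change M.map coprod.inl ≫ _ = M.map coprod.inl ≫ _
      rw [← Category.assoc, ← M.map_comp, coprod.inl_desc, ← Category.assoc, ← M.map_comp,
        coprod.inl_desc]
      exact hS
    · change M.map coprod.inr ≫ _ = M.map coprod.inr ≫ _
      rw [← Category.assoc, ← M.map_comp, coprod.inr_desc, ← Category.assoc, ← M.map_comp,
        coprod.inr_desc]
      exact hT

end UniversalModel

/-! ### Generation of a topos by its site -/

section Density

variable {D : Type u} [SmallCategory D] (K : GrothendieckTopology D) {E : Type w} [Category.{u} E]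

/-- The canonical functor from a small site to its topos of sheaves. -/
noncomputable abbrev sheafYoneda : D ⥤ Sheaf K (Type u) :=
  uliftYoneda.{u} ⋙ presheafToSheaf K (Type u)

variable {K} {M M' : Sheaf K (Type u) ⥤ E}
  [PreservesColimitsOfSize.{u, u} M]

instance isLeftKanExtension_presheafToSheaf_comp :
    (presheafToSheaf K (Type u) ⋙ M).IsLeftKanExtension
    (𝟙 (uliftYoneda.{u} ⋙ presheafToSheaf K (Type u) ⋙ M)) :=
  have : PreservesColimitsOfSize.{u, u} (presheafToSheaf K (Type u)) :=
    (sheafificationAdjunction K (Type u)).leftAdjoint_preservesColimits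
  have : PreservesColimitsOfSize.{u, u} (presheafToSheaf K (Type u) ⋙ M) :=
    comp_preservesColimits _ _
  Presheaf.isLeftKanExtension_of_preservesColimits.{u} (presheafToSheaf K (Type u) ⋙ M)
    (Iso.refl _)

theorem natTrans_ext_of_sheafYoneda {β β' : M ⟶ M'}
    (h : ∀ A, β.app ((sheafYoneda K).obj A) = β'.app ((sheafYoneda K).obj A)) : β = β' := by
  have h₁ : (presheafToSheaf K (Type u)).whiskerLeft β =
      (presheafToSheaf K (Type u)).whiskerLeft β' := by
    apply Functor.hom_ext_of_isLeftKanExtension _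
      (𝟙 (uliftYoneda.{u} ⋙ presheafToSheaf K (Type u) ⋙ M))
    ext A
    exact congrArg _ (h A)
  exact Localization.natTrans_ext (presheafToSheaf K (Type u)) K.W fun P => NatTrans.congr_app h₁ P

/-- A natural transformation on the site extends to a cocontinuous functor on the topos, since
presheaves are generated by representables and sheaves are a localization of presheaves. -/
theorem exists_natTrans_of_sheafYoneda (γ : sheafYoneda K ⋙ M ⟶ sheafYoneda K ⋙ M') :
    ∃ β : M ⟶ M', ∀ A, β.app ((sheafYoneda K).obj A) = γ.app A := by
  let γ' : uliftYoneda.{u} ⋙ presheafToSheaf K (Type u) ⋙ M ⟶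
    uliftYoneda.{u} ⋙ presheafToSheaf K (Type u) ⋙ M' := γ
  let δ := (presheafToSheaf K (Type u) ⋙ M).descOfIsLeftKanExtension
    (𝟙 (uliftYoneda.{u} ⋙ presheafToSheaf K (Type u) ⋙ M)) (presheafToSheaf K (Type u) ⋙ M') γ'
  refine ⟨Localization.liftNatTrans (presheafToSheaf K (Type u)) K.W
    (presheafToSheaf K (Type u) ⋙ M) (presheafToSheaf K (Type u) ⋙ M') M M' δ, fun A => ?_⟩
  refine (Localization.liftNatTrans_app _ _ _ _ _ _ _ _).trans ?_
  have := (presheafToSheaf K (Type u) ⋙ M).descOfIsLeftKanExtension_fac_app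
    (𝟙 (uliftYoneda.{u} ⋙ presheafToSheaf K (Type u) ⋙ M)) (presheafToSheaf K (Type u) ⋙ M') γ' A
  refine (Eq.trans ?_ this)
  rw [NatTrans.id_app, Category.id_comp]
  exact (Category.id_comp _).trans (Category.comp_id _)

end Density

/-! ### Jointly epic families -/

section JointlyEpi

/-- Cocontinuous functors preserve small jointly epic families. -/
theorem map_hom_ext_of_jointly_epi {D : Type u₁} [Category.{v₁} D] {E : Type u₂} [Category.{v₂} E]
    [HasColimitsOfSize.{u, u} D] (M : D ⥤ E) [PreservesColimitsOfSize.{u, u} M] {ι : Type u}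
    {A : ι → D} {X : D} (f : ∀ k, A k ⟶ X)
    (h : ∀ ⦃Z : D⦄ (a b : X ⟶ Z), (∀ k, f k ≫ a = f k ≫ b) → a = b) ⦃Z : E⦄
    (a b : M.obj X ⟶ Z) (hab : ∀ k, M.map (f k) ≫ a = M.map (f k) ≫ b) : a = b := by
  have hd : Epi (Sigma.desc f) := ⟨fun a b e => h a b fun k => by
    rw [← Sigma.ι_desc f k, Category.assoc, e, Category.assoc]⟩
  have : PreservesFiniteColimits M := PreservesColimitsOfSize.preservesFiniteColimits M
  rw [← cancel_epi (M.map (Sigma.desc f))]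
  refine (isColimitOfPreserves M (coproductIsCoproduct A)).hom_ext fun ⟨k⟩ => ?_
  change M.map (Sigma.ι A k) ≫ _ = M.map (Sigma.ι A k) ≫ _
  rw [← Functor.map_comp_assoc, ← Functor.map_comp_assoc, Sigma.ι_desc, hab]

variable {S : Type u} [SmallCategory S] {J : GrothendieckTopology S}

/-- A section of the target of a jointly epic family of maps of sheaves locally comes from a
member of the family. -/
theorem locally_exists_of_jointly_epi {ι : Type u} {A : ι → Sheaf J (Type u)} {X : Sheaf J (Type u)}
    (f : ∀ k, A k ⟶ X)
    (h : ∀ ⦃Z : Sheaf J (Type u)⦄ (a b : X ⟶ Z), (∀ k, f k ≫ a = f k ≫ b) → a = b) {s : S}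
    (x : X.obj.obj (.op s)) :
    J.Locally (fun _ r => ∃ k y, (f k).hom.app _ y = X.obj.map r.op x) := by
  let Q : Sᵒᵖ ⥤ Type u :=
    { obj s := Σ k, (A k).obj.obj s
      map r := ↾(fun z => ⟨z.1, (A z.1).obj.map r z.2⟩)
      map_id s := ConcreteCategory.hom_ext _ _ fun z =>
        congrArg (Sigma.mk z.1) (Functor.map_id_apply (A z.1).obj s z.2)
      map_comp r r' := ConcreteCategory.hom_ext _ _ fun z =>
        congrArg (Sigma.mk z.1) (Functor.map_comp_apply (A z.1).obj r r' z.2) }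
  let ψ : Q ⟶ X.obj :=
    { app s := ↾(fun z => (f z.1).hom.app s z.2)
      naturality s t r := by ext ⟨k, y⟩; exact NatTrans.naturality_apply (f k).hom r y }
  let i (k : ι) : (A k).obj ⟶ Q :=
    { app s := ↾(fun y => ⟨k, y⟩)
      naturality s t r := rfl }
  have hi (k : ι) : i k ≫ ψ = (f k).hom := rfl
  have hψ : Epi ((presheafToSheaf J (Type u)).map ψ) := by
    let adj := sheafificationAdjunction J (Type u)
    refine ⟨fun {Z} a b e => (adj.homEquiv _ _).injective ?_⟩
    replace e := (adj.homEquiv_naturality_left _ _).symm.trans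
      ((congrArg (adj.homEquiv _ _) e).trans (adj.homEquiv_naturality_left _ _))
    have := h (Z := Z) ⟨adj.homEquiv _ _ a⟩ ⟨adj.homEquiv _ _ b⟩ fun k => by
      ext : 1
      change (f k).hom ≫ _ = (f k).hom ≫ _
      rw [← hi, Category.assoc, e, Category.assoc]
    exact congrArg (fun z => z.hom) this
  have : Presheaf.IsLocallySurjective J ψ :=
    (Presheaf.isLocallySurjective_presheafToSheaf_map_iff J ψ).1
      ((Sheaf.isLocallySurjective_iff_epi _).2 hψ)
  refine (locally_exists_app_eq ψ x).mono ?_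
  rintro t r ⟨⟨k, y⟩, hy⟩
  exact ⟨k, y, hy⟩

/-- An initial sheaf has sections only over objects with empty cover. -/
theorem bot_mem_of_isInitial {I : Sheaf J (Type u)} (hI : IsInitial I) {s : S}
    (x : I.obj.obj (.op s)) : ⊥ ∈ J s := by
  obtain ⟨U, hU, h⟩ := locally_exists_of_jointly_epi (ι := PEmpty) (A := fun k => k.elim) (X := I)
    (fun k => k.elim) (fun _ a b _ => hI.hom_ext a b) x
  exact J.superset_covering (fun t f hf => (h f hf).choose.elim) hU

end JointlyEpi

/-! ### Representable sheaves on the category of ultrafilters -/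

section GermArrow

variable {C : Type u} [SmallCategory C] [CoherentCategory C]

/-- A germ on `(X, p)` with values in `Y`, as a map from the sheaf represented by `(X, p)` to the
sheaf of germs with values in `Y`. -/
noncomputable def germArrow {A : BooleanSpec C} {Y : C} (g : Germ A.type Y) :
    (sheafYoneda (BooleanSpec.topologyE C)).obj A ⟶ (typeModel C).obj Y :=
  (presheafToSheaf _ _).map (uliftYonedaEquiv.{u}.symm g : _ ⟶ (germPresheaf C).obj Y)

theorem germArrow_postcomp {A : BooleanSpec C} {Y Z : C} (g : Germ A.type Y) (f : Y ⟶ Z) :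
    germArrow g ≫ (typeModel C).map f = germArrow (g.postcomp f) := by
  refine ((presheafToSheaf _ _).map_comp _ _).symm.trans (congrArg _ ?_)
  ext B ⟨h⟩
  exact Germ.comp_postcomp h.1 h.2 g f

theorem map_germArrow {A B : BooleanSpec C} {Y : C} (k : A ⟶ B) (g : Germ B.type Y) :
    (sheafYoneda (BooleanSpec.topologyE C)).map k ≫ germArrow g = germArrow (k.1.comp k.2 g) := by
  refine ((presheafToSheaf _ _).map_comp _ _).symm.trans (congrArg _ ?_)
  ext D ⟨h⟩
  exact Germ.assoc h.1 h.2 k.1 k.2 g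

/-- The embedding of the sheaf represented by `(X, p)` into the sheaf of germs with values
in `X`. -/
noncomputable abbrev germInclusion (A : BooleanSpec C) :
    (sheafYoneda (BooleanSpec.topologyE C)).obj A ⟶ (typeModel C).obj A.obj :=
  germArrow (Germ.ofHom A.type (𝟙 A.obj))

theorem uliftYonedaEquiv_symm_ofHom_id (A B : BooleanSpec C) (h : B ⟶ A) :
    (uliftYonedaEquiv.{u}.symm (Germ.ofHom A.type (𝟙 A.obj)) :
      uliftYoneda.{u}.obj A ⟶ (germPresheaf C).obj A.obj).app (.op B) ⟨h⟩ = h.1 :=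
  (Germ.comp_ofHom h.1 h.2 _).trans (Germ.postcomp_id _)

instance (A : BooleanSpec C) : Mono (germInclusion A) := by
  have : Mono (uliftYonedaEquiv.{u}.symm (Germ.ofHom A.type (𝟙 A.obj)) :
      uliftYoneda.{u}.obj A ⟶ (germPresheaf C).obj A.obj) := by
    have (B : (BooleanSpec C)ᵒᵖ) : Mono ((uliftYonedaEquiv.{u}.symm (Germ.ofHom A.type (𝟙 A.obj)) :
        uliftYoneda.{u}.obj A ⟶ (germPresheaf C).obj A.obj).app B) := by
      rw [mono_iff_injective]
      rintro ⟨h⟩ ⟨h'⟩ e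
      exact congrArg _ (Subtype.ext ((uliftYonedaEquiv_symm_ofHom_id A _ h).symm.trans
        (e.trans (uliftYonedaEquiv_symm_ofHom_id A _ h'))))
    exact NatTrans.mono_of_mono_app _
  exact inferInstanceAs (Mono ((presheafToSheaf _ _).map _))

/-- The sheaf of germs with values in `X` is covered by the sheaves represented by the `(X, p)`. -/
theorem typeModel_ext_of_germInclusion {X : C} ⦃Z : TypeTopos C⦄ (a b : (typeModel C).obj X ⟶ Z)
    (h : ∀ p : BooleanType X, germInclusion ⟨X, p⟩ ≫ a = germInclusion ⟨X, p⟩ ≫ b) : a = b := by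
  let adj := sheafificationAdjunction (BooleanSpec.topologyE C) (Type u)
  apply (adj.homEquiv _ _).injective
  ext ⟨A⟩ g
  obtain ⟨q, hq⟩ := Germ.exists_isContinuous g
  have e := (adj.homEquiv_naturality_left _ _).symm.trans ((congrArg (adj.homEquiv _ _) (h q)).trans
    (adj.homEquiv_naturality_left _ _))
  have e' := ConcreteCategory.congr_hom (NatTrans.congr_app e (.op A)) ⟨(⟨g, hq⟩ : A ⟶ ⟨X, q⟩)⟩
  have k := uliftYonedaEquiv_symm_ofHom_id ⟨X, q⟩ A ⟨g, hq⟩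
  exact (congrArg ((adj.homEquiv _ _ a).app (.op A)) k).symm.trans
    (e'.trans (congrArg ((adj.homEquiv _ _ b).app (.op A)) k))

end GermArrow

/-! ### Full faithfulness -/

section FullyFaithful

variable {C : Type u} [SmallCategory C] [CoherentCategory C] {S : Type u} [SmallCategory S]
  {J : GrothendieckTopology S} {M : TypeTopos C ⥤ Sheaf J (Type u)}

theorem map_typeModel_ext_of_germInclusion [PreservesColimitsOfSize.{u, u} M] {X : C}
    ⦃Z : Sheaf J (Type u)⦄ (a b : M.obj ((typeModel C).obj X) ⟶ Z)
    (h : ∀ p : BooleanType X, M.map (germInclusion ⟨X, p⟩) ≫ a = M.map (germInclusion ⟨X, p⟩) ≫ b) :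
    a = b := by
  have : HasColimitsOfSize.{u, u} (TypeTopos C) :=
    hasColimits_of_reflective (sheafToPresheaf (BooleanSpec.topologyE C) (Type u))
  exact map_hom_ext_of_jointly_epi M (fun p : BooleanType X => germInclusion ⟨X, p⟩)
    typeModel_ext_of_germInclusion a b h

theorem map_germInclusion_mem_realisers {A : BooleanSpec C} {s : Sᵒᵖ}
    (z : (M.obj ((sheafYoneda _).obj A)).obj.obj s) :
    (M.map (germInclusion A)).hom.app s z ∈
      A.type.realisers (sectionsFunctor (typeModel C ⋙ M) s) := by
  intro V hV
  refine ⟨(M.map (germArrow (Germ.toMem A.type V hV))).hom.app s z, ?_⟩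
  rw [germInclusion, ← Germ.toMem_postcomp_arrow V hV, ← germArrow_postcomp, M.map_comp]
  rfl

theorem locallyRealises_typeModel_comp [PreservesColimitsOfSize.{u, u} M] :
    LocallyRealises (typeModel C ⋙ M) where
  bot_mem hX _ a :=
    bot_mem_of_isInitial ((nonempty_isInitial_typeModel hX).some.isInitialObj M) a
  exists_realised {X s} a := by
    refine (locally_exists_of_jointly_epi
      (fun p : BooleanType X => M.map (germInclusion ⟨X, p⟩))
      map_typeModel_ext_of_germInclusion a).mono ?_
    rintro t f ⟨p, y, hy⟩
    exact ⟨p, hy ▸ map_germInclusion_mem_realisers y⟩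

/-- Natural transformations out of an inverse image functor are determined by their restriction to
the coherent category. -/
theorem natTrans_ext_of_typeModel [PreservesColimitsOfSize.{u, u} M]
    {M' : TypeTopos C ⥤ Sheaf J (Type u)} [PreservesFiniteLimits M'] {β β' : M ⟶ M'}
    (h : (typeModel C).whiskerLeft β = (typeModel C).whiskerLeft β') : β = β' := by
  refine natTrans_ext_of_sheafYoneda fun A => ?_
  rw [← cancel_mono (M'.map (germInclusion A)), ← NatTrans.naturality, ← NatTrans.naturality]
  exact congrArg _ (NatTrans.congr_app h A.obj)

variable [PreservesFiniteLimits M]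

instance : PreservesFiniteLimits (typeModel C ⋙ M) := comp_preservesFiniteLimits _ _

/-- Evaluating a germ `g` at a realiser coming from the sheaf represented by `(X, p)` is applying
the map given by `g`. -/
theorem eval_map_germInclusion {A : BooleanSpec C} {Y : C} (g : Germ A.type Y) {s : Sᵒᵖ}
    (z : (M.obj ((sheafYoneda _).obj A)).obj.obj s) :
    g.eval (sectionsFunctor (typeModel C ⋙ M) s)
      ⟨(M.map (germInclusion A)).hom.app s z, map_germInclusion_mem_realisers z⟩ =
    (M.map (germArrow g)).hom.app s z := by
  have key {Y Z : C} (g : Germ A.type Y) (f : Y ⟶ Z) :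
      (M.map ((typeModel C).map f)).hom.app s ((M.map (germArrow g)).hom.app s z) =
        (M.map (germArrow (g.postcomp f))).hom.app s z := by
    rw [← germArrow_postcomp, M.map_comp]
    rfl
  induction g using Germ.ind with | _ k
  rw [Germ.eval_mk (sectionsFunctor (typeModel C ⋙ M) s) k _
    ((M.map (germArrow (Germ.toMem A.type k.dom k.dom_mem))).hom.app s z)]
  · exact (key _ _).trans (by rw [Germ.toMem_postcomp])
  · exact (key _ _).trans (by rw [Germ.toMem_postcomp_arrow])

variable (M) in
/-- The comparison of the inverse image of the sheaf represented by `(X, p)` with the sheaf of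
realisers of `p`. -/
noncomputable def realisersComparison :
    sheafYoneda (BooleanSpec.topologyE C) ⋙ M ⟶ realisersFunctor (typeModel C ⋙ M) where
  app A := ⟨
    { app s := ↾(fun z =>
        ⟨(M.map (germInclusion A)).hom.app s z, map_germInclusion_mem_realisers z⟩)
      naturality s t f := by
        ext z
        have := NatTrans.naturality_apply (M.map (germInclusion A)).hom f z
        exact Subtype.ext this }⟩
  naturality A B k := by
    ext s z
    refine Subtype.ext (Eq.trans ?_ (eval_map_germInclusion k.1 z).symm)
    have := map_germArrow k (Germ.ofHom B.type (𝟙 B.obj))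
    rw [Germ.comp_ofHom, Germ.postcomp_id] at this
    rw [← this, M.map_comp]
    rfl

theorem realisersComparison_ι (A : BooleanSpec C) :
    (realisersComparison M).app A ≫ realisersι (typeModel C ⋙ M) A = M.map (germInclusion A) := rfl

variable [PreservesColimitsOfSize.{u, u} M]

/-- A realiser of `p` comes locally from the sheaf represented by some `(X, q)`, and then it
realises both `p` and `q`, so that `p = q` unless the cover is empty. -/
instance isIso_realisersComparison : IsIso (realisersComparison M) := by
  have (A : BooleanSpec C) : IsIso ((realisersComparison M).app A) := by
    have : Mono ((realisersComparison M).app A) := by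
      have : Mono ((realisersComparison M).app A ≫ realisersι (typeModel C ⋙ M) A) :=
        inferInstanceAs (Mono (M.map (germInclusion A)))
      exact mono_of_mono _ (realisersι (typeModel C ⋙ M) A)
    have : Sheaf.IsLocallySurjective ((realisersComparison M).app A) := by
      refine isLocallySurjective_of_locally _ ?_
      rintro s ⟨a, ha⟩
      refine (locally_exists_of_jointly_epi
        (fun p : BooleanType A.obj => M.map (germInclusion ⟨A.obj, p⟩))
        map_typeModel_ext_of_germInclusion a).bind ?_
      rintro t f ⟨p, y, hy⟩
      by_cases hp : p = A.type
      · subst hp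
        refine .of_forall fun t' f' =>
          ⟨(M.obj ((sheafYoneda _).obj A)).obj.map f'.op y, Subtype.ext ?_⟩
        refine (NatTrans.naturality_apply (M.map (germInclusion A)).hom f'.op y).trans ?_
        refine (congrArg _ hy).trans ?_
        rw [op_comp]
        exact (Functor.map_comp_apply _ _ _ _).symm
      · refine .of_bot_mem (locallyRealises_typeModel_comp.bot_mem_of_ne hp
          (map_germInclusion_mem_realisers y) ?_)
        have := BooleanType.app_mem_realisers
          (sectionsFunctorMap (typeModel C ⋙ M) f.op) ha
        exact Set.mem_of_eq_of_mem hy this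
    have := Sheaf.epi_of_isLocallySurjective ((realisersComparison M).app A)
    exact isIso_of_mono_of_epi _
  exact NatIso.isIso_of_isIso_app _

variable {M' : TypeTopos C ⥤ Sheaf J (Type u)} [PreservesFiniteLimits M']
  [PreservesColimitsOfSize.{u, u} M']

/-- Natural transformations between restrictions of inverse image functors extend: they act on
realisers of ultrafilters. -/
theorem exists_whiskerLeft_typeModel_eq (α : typeModel C ⋙ M ⟶ typeModel C ⋙ M') :
    ∃ β : M ⟶ M', (typeModel C).whiskerLeft β = α := by
  obtain ⟨β, hβ⟩ := exists_natTrans_of_sheafYoneda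
    (realisersComparison M ≫ realisersFunctorMap α ≫ inv (realisersComparison M'))
  refine ⟨β, ?_⟩
  ext X : 2
  refine map_typeModel_ext_of_germInclusion _ _ fun p => ?_
  rw [Functor.whiskerLeft_app, NatTrans.naturality, hβ, ← realisersComparison_ι (M := M'),
    ← realisersComparison_ι (M := M), Category.assoc, ← realisersFunctorMap_ι α ⟨X, p⟩]
  simp

end FullyFaithful

/-! ### Connected objects and ultrafilters -/

section Extensive

variable {E : Type u₁} [Category.{v₁} E]

/-- In an extensive category the coproduct of disjoint subobjects is a subobject. -/
theorem mono_sigmaDesc_of_disjoint [FinitaryPreExtensive E] [HasPullbacks E] {ι : Type*} [Finite ι]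
    {Y : E} {X : ι → E} (f : ∀ i, X i ⟶ Y) (hf : ∀ i, Mono (f i))
    (h : ∀ i j, i ≠ j → Nonempty (IsInitial (pullback (f i) (f j)))) : Mono (Sigma.desc f) := by
  classical
  refine IsKernelPair.mono_of_eq_fst_snd (FinitaryPreExtensive.isPullback_sigmaDesc f f) ?_
  refine Sigma.hom_ext _ _ ?_
  rintro ⟨i, j⟩
  rw [Sigma.ι_desc, Sigma.ι_desc]
  by_cases hij : i = j
  · subst hij
    have := hf i
    rw [(cancel_mono (f i)).1 (pullback.condition (f := f i) (g := f i))]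
  · exact (h i j hij).some.hom_ext _ _

theorem nonempty_isColimit_binaryCofan_of_isIso {X : WalkingPair → E} [HasCoproduct X] {Y : E}
    (f : ∀ i, X i ⟶ Y) [IsIso (Sigma.desc f)] :
    Nonempty (IsColimit (BinaryCofan.mk (f .left) (f .right))) := by
  have e (i : WalkingPair) : f i ≫ inv (Sigma.desc f) = Sigma.ι X i := by
    rw [IsIso.comp_inv_eq, Sigma.ι_desc]
  refine ⟨BinaryCofan.isColimitMk
    (fun s => inv (Sigma.desc f) ≫ Sigma.desc (fun | .left => s.inl | .right => s.inr))
    (fun s => ?_) (fun s => ?_) (fun s m hl hr => ?_)⟩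
  · rw [← Category.assoc, e, Sigma.ι_desc]
  · rw [← Category.assoc, e, Sigma.ι_desc]
  · rw [IsIso.eq_inv_comp]
    refine Sigma.hom_ext _ _ ?_
    rintro (_ | _)
    · rw [Sigma.ι_desc, Sigma.ι_desc_assoc, hl]
    · rw [Sigma.ι_desc, Sigma.ι_desc_assoc, hr]

/-- A map from a connected object to a coproduct factors through a summand. -/
theorem IsConnectedObject.exists_factor {E : Type w} [Category.{u} E] [FinitaryPreExtensive E]
    [HasPullbacks E] {A : E} (hA : IsConnectedObject A) {Y : E} {X : WalkingPair → E}
    (f : ∀ i, X i ⟶ Y) [hf : IsIso (Sigma.desc f)] (a : A ⟶ Y) :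
    (∃ l : A ⟶ X .left, l ≫ f .left = a) ∨ ∃ l : A ⟶ X .right, l ≫ f .right = a := by
  have := FinitaryPreExtensive.isIso_sigmaDesc_fst f a hf
  obtain ⟨hc⟩ := nonempty_isColimit_binaryCofan_of_isIso (fun i => pullback.fst a (f i))
  rcases hA.indecomposable _ _ hc with ⟨⟨h⟩⟩ | ⟨⟨h⟩⟩
  · have : IsIso (pullback.fst a (f .right)) := (BinaryCofan.isColimit_iff_isIso_inr h _).1 ⟨hc⟩
    exact Or.inr ⟨inv (pullback.fst a (f .right)) ≫ pullback.snd _ _, by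
      rw [Category.assoc, ← pullback.condition, IsIso.inv_hom_id_assoc]⟩
  · have : IsIso (pullback.fst a (f .left)) := (BinaryCofan.isColimit_iff_isIso_inl h _).1 ⟨hc⟩
    exact Or.inl ⟨inv (pullback.fst a (f .left)) ≫ pullback.snd _ _, by
      rw [Category.assoc, ← pullback.condition, IsIso.inv_hom_id_assoc]⟩

end Extensive

section ConnectedType

theorem IsCoherentFunctor.nonempty_isInitial {C : Type u₁} [Category.{v₁} C]
    {E : Type w} [Category.{u} E] [FinitaryPreExtensive E] {F : C ⥤ E}
    (hF : IsCoherentFunctor F) {X : C} {V : Subobject X}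
    (hV : IsBot V) : Nonempty (IsInitial (F.obj (V : C))) := by
  have := hF.toPreservesFiniteLimits
  have h := hF.isBot_map V hV (Subobject.mk (initial.to (F.obj X)))
  exact ⟨initialIsInitial.ofStrict (Subobject.ofMkLEMk _ _ h)⟩

variable {C : Type u₁} [Category.{v₁} C] [CoherentCategory C] {E : Type w} [Category.{u} E]
  [FinitaryExtensive E] [HasFiniteLimits E] {F : C ⥤ E}

theorem IsCoherentFunctor.isIso_sigmaDesc [Balanced E] (hF : IsCoherentFunctor F) {X : C}
    {V W : Subobject X} (h : IsComplement V W) :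
    IsIso (Sigma.desc (fun i : WalkingPair => F.map (i.casesOn V W : Subobject X).arrow)) := by
  have := hF.toPreservesFiniteLimits
  have hP : IsInitial (pullback (F.map V.arrow) (F.map W.arrow)) :=
    (hF.nonempty_isInitial h.1).some.ofStrict
      (((Subobject.inf_isPullback V W).map F).lift
        (pullback.fst _ _) (pullback.snd _ _) pullback.condition)
  have : Mono (Sigma.desc (fun i : WalkingPair => F.map (i.casesOn V W : Subobject X).arrow)) := by
    refine mono_sigmaDesc_of_disjoint _ (fun i => inferInstance) ?_
    rintro (_ | _) (_ | _) hij
    · exact (hij rfl).elim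
    · exact ⟨hP⟩
    · exact ⟨hP.ofIso (pullbackSymmetry _ _)⟩
    · exact (hij rfl).elim
  have : Epi (Sigma.desc (fun i : WalkingPair => F.map (i.casesOn V W : Subobject X).arrow)) := by
    refine ⟨fun a b e => ?_⟩
    have hle {U : Subobject X} (hU : F.map U.arrow ≫ a = F.map U.arrow ≫ b) :
        Subobject.mapLex F U ≤ Subobject.mk (equalizer.ι a b) :=
      Subobject.mk_le_mk_of_comm (equalizer.lift _ hU) (equalizer.lift_ι _ _)
    have htop : Subobject.mapLex F ⊤ ≤ Subobject.mk (equalizer.ι a b) :=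
      (hF.isLUB_map _ _ _ h.2).2 (by
      rintro _ (rfl | rfl)
      · refine hle ?_
        simpa using Sigma.ι _ WalkingPair.left ≫= e
      · refine hle ?_
        simpa using Sigma.ι _ WalkingPair.right ≫= e)
    rw [← cancel_epi (F.map (⊤ : Subobject X).arrow), ← Subobject.ofMkLEMk_comp htop,
      Category.assoc, equalizer.condition, Category.assoc]
  exact isIso_of_mono_of_epi _

/-- The ultrafilter on `X` of the complemented subobjects `V` such that a given map from a
connected object to `F X` factors through `F V`. -/
def connectedType [Balanced E] (hF : IsCoherentFunctor F) {A : E} (hA : IsConnectedObject A) {X : C}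
    (a : A ⟶ F.obj X) : BooleanType X where
  carrier := {V | IsComplementedSubobject V ∧ ∃ l, l ≫ F.map V.arrow = a}
  complemented h := h.1
  top_mem := ⟨isComplementedSubobject_top X, a ≫ inv (F.map (⊤ : Subobject X).arrow), by simp⟩
  inf_mem := by
    rintro V W ⟨hV, l, hl⟩ ⟨hW, m, hm⟩
    have := hF.toPreservesFiniteLimits
    refine ⟨?_, ((Subobject.inf_isPullback V W).map F).lift l m (hl.trans hm.symm), ?_⟩
    · rw [Subobject.inf_eq_map_pullback]
      exact hV.map_pullback V.arrow hW
    · rw [← Subobject.ofLE_arrow (inf_le_left : V ⊓ W ≤ V), F.map_comp, ← Category.assoc,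
        IsPullback.lift_fst, hl]
  mem_of_le := by
    rintro V W ⟨hV, l, hl⟩ hVW hW
    refine ⟨hW, l ≫ F.map (Subobject.ofLE V W hVW), ?_⟩
    rw [Category.assoc, ← F.map_comp, Subobject.ofLE_arrow, hl]
  not_mem_of_isBot := by
    rintro V hV ⟨-, l, -⟩
    exact hA.not_isInitial.false ((hF.nonempty_isInitial hV).some.ofStrict l)
  mem_or_mem {V W} h := by
    have := hF.isIso_sigmaDesc h
    refine (hA.exists_factor (fun i : WalkingPair => F.map (i.casesOn V W : Subobject X).arrow)
      a).imp ?_ ?_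
    · exact fun h' => ⟨⟨W, h⟩, h'⟩
    · exact fun h' => ⟨⟨V, h.symm⟩, h'⟩

end ConnectedType

section LocallyConnected

variable {C : Type u} [SmallCategory C] [CoherentCategory C] {E : Type w} [Category.{u} E]
  [FinitaryExtensive E] [HasFiniteLimits E] [Balanced E] {F : C ⥤ E} {S : Type u}
  [SmallCategory S] {J : GrothendieckTopology S}

/-- Sections of a coproduct of connected objects locally realise ultrafilters. -/
theorem IsCoherentFunctor.locallyRealises (hF : IsCoherentFunctor F)
    (hE : IsLocallyConnectedTopos E) (G : E ⥤ Sheaf J (Type u))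
    [PreservesColimitsOfSize.{u, u} G] : LocallyRealises (F ⋙ G) where
  bot_mem {X} hX _ a := by
    have := hF.toPreservesFiniteLimits
    have hI := (hF.nonempty_isInitial hX).some.ofIso (asIso (F.map (⊤ : Subobject X).arrow))
    have : PreservesFiniteColimits G := PreservesColimitsOfSize.preservesFiniteColimits G
    exact bot_mem_of_isInitial (hI.isInitialObj G) a
  exists_realised {X s} a := by
    obtain ⟨ι, A, i, hA, ⟨hi⟩⟩ := hE (F.obj X)
    refine (locally_exists_of_jointly_epi (fun k => G.map (i k)) (fun Z a b h => ?_) a).mono ?_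
    · exact (isColimitOfPreserves G hi).hom_ext fun ⟨k⟩ => h k
    · rintro t f ⟨k, y, hy⟩
      refine ⟨connectedType hF (hA k) (i k), ?_⟩
      rintro V ⟨-, l, hl⟩
      refine ⟨(G.map l).hom.app _ y, ?_⟩
      refine Eq.trans ?_ hy
      rw [← hl, G.map_comp]
      rfl

end LocallyConnected

/-! ### Grothendieck toposes -/

section Transport

variable {E : Type w} [Category.{u} E] {S : Type u} [SmallCategory S]
  {J : GrothendieckTopology S}

theorem hasFiniteLimits_of_equivalence_sheaf (e : E ≌ Sheaf J (Type u)) : HasFiniteLimits E :=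
  ⟨fun _ _ _ => Adjunction.hasLimitsOfShape_of_equivalence e.functor⟩

theorem balanced_of_equivalence_sheaf (e : E ≌ Sheaf J (Type u)) : Balanced E :=
  ⟨fun f _ _ => by
    have := isIso_of_mono_of_epi (e.functor.map f)
    exact isIso_of_reflects_iso f e.functor⟩

theorem isRegularEpiCategory_of_equivalence_sheaf (e : E ≌ Sheaf J (Type u)) :
    IsRegularEpiCategory E :=
  have := hasFiniteLimits_of_equivalence_sheaf e
  ⟨fun f _ => by
    have : IsRegularEpi (e.functor.map f) := IsRegularEpiCategory.regularEpiOfEpi _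
    have : EffectiveEpi (e.functor.map f) := (isRegularEpi_iff_effectiveEpi _).1 this
    have : EffectiveEpi f := e.functor.effectiveEpi_of_map f this
    exact (isRegularEpi_iff_effectiveEpi _).2 this⟩

theorem finitaryExtensive_of_equivalence_sheaf (e : E ≌ Sheaf J (Type u)) : FinitaryExtensive E :=
  have := hasFiniteLimits_of_equivalence_sheaf e
  have : HasFiniteCoproducts E :=
    ⟨fun n =>
      have : HasColimitsOfShape (Discrete (Fin n)) (Sheaf J (Type u)) :=
        hasColimitsOfShape_of_reflective (sheafToPresheaf J (Type u))
      Adjunction.hasColimitsOfShape_of_equivalence e.functor⟩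
  finitaryExtensive_of_preserves_and_reflects_isomorphism e.functor

variable {C : Type u} [SmallCategory C] [CoherentCategory C]

theorem lexCocontinuous_comp_equivalence (e : E ≌ Sheaf J (Type u))
    {M : TypeTopos C ⥤ E} (hM : lexCocontinuous _ _ M) :
    lexCocontinuous _ _ (M ⋙ e.functor) :=
  have := hM.1
  have := hM.2
  ⟨comp_preservesFiniteLimits _ _, comp_preservesColimits _ _⟩

theorem existsUnique_whiskerLeft_typeModel_eq (e : E ≌ Sheaf J (Type u)) {M M' : TypeTopos C ⥤ E}
    (hM : lexCocontinuous _ _ M) (hM' : lexCocontinuous _ _ M')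
    (α : typeModel C ⋙ M ⟶ typeModel C ⋙ M') :
    ∃! β : M ⟶ M', (typeModel C).whiskerLeft β = α := by
  have h₁ := lexCocontinuous_comp_equivalence e hM
  have h₂ := lexCocontinuous_comp_equivalence e hM'
  have := h₁.1
  have := h₁.2
  have := h₂.1
  have := h₂.2
  let W := e.fullyFaithfulFunctor.whiskeringRight (TypeTopos C)
  obtain ⟨β, hβ⟩ := exists_whiskerLeft_typeModel_eq (M := M ⋙ e.functor) (M' := M' ⋙ e.functor)
    (Functor.whiskerRight α e.functor)
  refine ⟨W.preimage β, ?_, fun β' h => W.map_injective ?_⟩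
  · ext X
    apply e.functor.map_injective
    have h : Functor.whiskerRight (W.preimage β) e.functor = β := W.map_preimage β
    exact (NatTrans.congr_app h _).trans (NatTrans.congr_app hβ X)
  · rw [W.map_preimage]
    refine natTrans_ext_of_typeModel (M := M ⋙ e.functor)
      (M' := M' ⋙ e.functor) (Eq.trans ?_ hβ.symm)
    rw [← h]
    rfl

/-- Every coherent functor to a locally connected topos is a restriction of an inverse image
functor. -/
theorem exists_nonempty_typeModel_comp_iso (e : E ≌ Sheaf J (Type u))
    {F : C ⥤ E} (hF : IsCoherentFunctor F)
    (hE : IsLocallyConnectedTopos E) :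
    ∃ M : TypeTopos C ⥤ E, lexCocontinuous _ _ M ∧ Nonempty (typeModel C ⋙ M ≅ F) := by
  have := hasFiniteLimits_of_equivalence_sheaf e
  have := balanced_of_equivalence_sheaf e
  have := finitaryExtensive_of_equivalence_sheaf e
  have := hF.toPreservesFiniteLimits
  have : PreservesFiniteLimits (F ⋙ e.functor) := comp_preservesFiniteLimits _ _
  have hR : LocallyRealises (F ⋙ e.functor) := hF.locallyRealises hE e.functor
  have hepi {X Y : C} (f : X ⟶ Y) (hf : EffectiveEpi f) : Epi ((F ⋙ e.functor).map f) := by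
    have := hF.effectiveEpi_map f hf
    exact inferInstanceAs (Epi (e.functor.map (F.map f)))
  obtain ⟨i⟩ := hR.nonempty_iso_realisersExtension hepi
  obtain ⟨_, _⟩ := hR.lexCocontinuous_realisersExtension hepi
  refine ⟨realisersExtension (F ⋙ e.functor) ⋙ e.inverse,
    ⟨comp_preservesFiniteLimits _ _, comp_preservesColimits _ _⟩, ⟨?_⟩⟩
  exact (Functor.associator _ _ _).symm ≪≫ Functor.isoWhiskerRight i e.inverse ≪≫
    Functor.associator _ _ _ ≪≫ Functor.isoWhiskerLeft F e.unitIso.symm ≪≫ F.rightUnitor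

end Transport

theorem theorem3 (C : Type u) [SmallCategory C] [CoherentCategory C]
    (hC : HasFiniteDisjointCoproducts C ∨ IsBooleanCategory C) :
    IsCoherentFunctor (typeModel C) ∧
    ∀ (E : Type w) [Category.{u} E], IsGrothendieckTopos E →
      ∃ h : ∀ M : TypeTopos C ⥤ E, lexCocontinuous (TypeTopos C) E M →
          coherentFunctors C E (typeModel C ⋙ M),
        (precompose (typeModel C) h).Full ∧ (precompose (typeModel C) h).Faithful ∧
        (IsLocallyConnectedTopos E → (precompose (typeModel C) h).IsEquivalence) := by
  refine ⟨isCoherentFunctor_typeModel hC, ?_⟩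
  rintro E _ ⟨S, _, J, ⟨e⟩⟩
  have := hasFiniteLimits_of_equivalence_sheaf e
  have := balanced_of_equivalence_sheaf e
  have := isRegularEpiCategory_of_equivalence_sheaf e
  let h (M : TypeTopos C ⥤ E) (hM : lexCocontinuous (TypeTopos C) E M) :
      coherentFunctors C E (typeModel C ⋙ M) := isCoherentFunctor_typeModel_comp hC hM
  have full : (precompose (typeModel C) h).Full := ⟨fun {M M'} α => by
    obtain ⟨β, hβ, -⟩ := existsUnique_whiskerLeft_typeModel_eq e M.property M'.property α.hom
    exact ⟨⟨β⟩, by ext1; exact hβ⟩⟩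
  have faithful : (precompose (typeModel C) h).Faithful := ⟨fun {M M'} β β' hβ => by
    ext1
    exact (existsUnique_whiskerLeft_typeModel_eq e M.property M'.property _).unique
      (congrArg (fun k => k.hom) hβ) rfl⟩
  refine ⟨h, full, faithful, fun hE => ⟨faithful, full, ⟨fun F => ?_⟩⟩⟩
  obtain ⟨M, hM, ⟨i⟩⟩ := exists_nonempty_typeModel_comp_iso e F.property hE
  exact ⟨⟨M, hM⟩, ⟨ObjectProperty.isoMk _ i⟩⟩
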